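/- Let $d\ge1$, let $\Omega\subset\mathbb R^d$ be a bounded open set (for instance a bounded Lipschitz domain), and let $0<\alpha<1$, $T>0$ and $m\ge1$. Write $\langle\cdot,\cdot\rangle$ and $\|\cdot\|$ for the inner product and norm of $L_2(\Omega)$ (or $L_2(\Omega)^d$), and $\omega_\alpha(t)=t^{\alpha-1}/\Gamma(\alpha)$. Let $\kappa\in L_\infty(\Omega)^{d\times d}$ be such that $\kappa(x)$ is real, symmetric and positive definite with minimal eigenvalue bounded away from zero uniformly for almost every $x\in\Omega$, and let $$\vec F,\vec G\in C^{m+1}\bigl([0,T];W^1_\infty(\Omega)^d\bigr),\qquad a,b\in C^m\bigl([0,T];L_\infty(\Omega)\bigr).$$ For $v,w\in H^1_0(\Omega)$ put $$\langle K_1(t)v,w\rangle=\langle\kappa\nabla v,\nabla w\rangle-\langle\vec F(t)v,\nabla w\rangle+\langle a(t)v,w\rangle,\qquad \langle K_2(t)v,w\rangle=\langle b(t)v,w\rangle-\langle\vec G(t)v,\nabla w\rangle,$$ $$\langle K_1'(t)v,w\rangle=-\langle\vec F'(t)v,\nabla w\rangle+\langle a'(t)v,w\rangle,\qquad K(t,s)=\omega_\alpha(t-s)K_1(t)+K_2(s)-\int_s^t\omega_\alpha(z-s)K_1'(z)\,dz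 .$$ Let $X$ be a finite-dimensional subspace of $H^1_0(\Omega)$ with the norm $\|\cdot\|_X=\|\cdot\|_{H^1_0(\Omega)}$, and let $K_X(t,s):X\to X$ be defined by $\langle K_X(t,s)v,w\rangle=\langle K(t,s)v,w\rangle$ for all $v,w\in X$. Let $C^m_\alpha=C^m_\alpha([0,T];X)$ be the space of continuous functions $v:[0,T]\to X$ that are $C^m$ on $(0,T]$ and for which $|v|_{j,\alpha}=\sup_{0<t\le T}t^{j-\alpha}\|v^{(j)}(t)\|_X$ is finite for $1\le j\le m$, with the norm $\|v\|_{m,\alpha}=\max_{0\le t\le T}\|v(t)\|_X+\sum_{j=1}^m|v|_{j,\alpha}$. Then there are positive constants $C_X$ and $C_X'$, depending only on $\Omega$, $\alpha$, $T$, $m$, the coefficients $\kappa,\vec F,\vec G,a,b$ and $X$, such that the following holds. Let $u_0\in L_2(\Omega)$, let $g:(0,T]\to L_2(\Omega)$ be $C^m$, and suppose that $M$ is a constant with $$\|g^{(i-1)}(t)\|\le Mt^{\alpha-i}\qquad\text{for }0<t\le T\text{ and }1\le i\le m.$$ Let $f_X(t)\in X$ be the $L_2(\Omega)$-projection onto $X$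 of $u_0+\int_0^tg(s)\,ds$. Then the Volterra equation $$u_X(t)+\int_0^tK_X(t,s)u_X(s)\,ds=f_X(t)\qquad\text{for }0\le t\le T$$ has a unique continuous solution $u_X:[0,T]\to X$; moreover $f_X\in C^m_\alpha$, $u_X\in C^m_\alpha$, and $$\|u_X\|_{m,\alpha}\le C_X\|f_X\|_{m,\alpha}\le C_X'\bigl(\|u_0\|+M\bigr).$$ -/

import Mathlib

open MeasureTheory Set TopologicalSpace
open scoped ENNReal

noncomputable section

namespace FracPDE

/-! ### Lebesgue and Sobolev spaces on an open set `Ω ⊆ ℝᵈ` -/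

/-- Euclidean space `ℝᵈ`. -/
abbrev E (d : ℕ) : Type := EuclideanSpace ℝ (Fin d)

/-- Lebesgue measure on `Ω`. -/
abbrev vol {d : ℕ} (Ω : Opens (E d)) : Measure (E d) := volume.restrict (Ω : Set (E d))

/-- `L_∞(Ω)`. -/
abbrev Linf {d : ℕ} (Ω : Opens (E d)) : Type := Lp ℝ ∞ (vol Ω)

/-- `L_2(Ω)`. -/
abbrev L2 {d : ℕ} (Ω : Opens (E d)) : Type := Lp ℝ 2 (vol Ω)

/-- The classical partial derivative `∂ᵢ φ`. -/
def pderiv {d : ℕ} (i : Fin d) (φ : E d → ℝ) (x : E d) : ℝ :=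
  fderiv ℝ φ x (EuclideanSpace.single i 1)

/-- `g` is the `i`-th weak partial derivative of `f` on `Ω`. -/
def IsWeakPartial {d : ℕ} (Ω : Opens (E d)) (i : Fin d) (f g : E d → ℝ) : Prop :=
  ∀ φ : TestFunction Ω ℝ ⊤,
    ∫ x in (Ω : Set (E d)), f x * pderiv i φ x = - ∫ x in (Ω : Set (E d)), g x * φ x

section helpers

variable {d : ℕ} {Ω : Opens (E d)}

lemma continuous_pderiv (i : Fin d) (φ : TestFunction Ω ℝ ⊤) : Continuous (pderiv i φ) := by
  have h : ContDiff ℝ 1 φ := φ.contDiff.of_le (by norm_cast)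
  exact (h.continuous_fderiv (by simp)).clm_apply continuous_const

lemma hasCompactSupport_pderiv (i : Fin d) (φ : TestFunction Ω ℝ ⊤) :
    HasCompactSupport (pderiv i φ) :=
  φ.hasCompactSupport.fderiv_apply (𝕜 := ℝ) _

lemma memLp_test (p : ℝ≥0∞) (φ : TestFunction Ω ℝ ⊤) : MemLp φ p (vol Ω) :=
  φ.continuous.memLp_of_hasCompactSupport φ.hasCompactSupport

lemma memLp_pderiv (p : ℝ≥0∞) (i : Fin d) (φ : TestFunction Ω ℝ ⊤) :
    MemLp (pderiv i φ) p (vol Ω) :=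
  (continuous_pderiv i φ).memLp_of_hasCompactSupport (hasCompactSupport_pderiv i φ)

lemma integrable_mul_of_top {f g : E d → ℝ} (hf : MemLp f ∞ (vol Ω)) (hg : MemLp g 1 (vol Ω)) :
    Integrable (fun x => f x * g x) (vol Ω) := by
  have := MemLp.integrable_mul (p := ∞) (q := 1) hf hg
  exact this

end helpers

/-- The Sobolev space `W¹_∞(Ω)`: essentially bounded functions `w.1` together with their
essentially bounded weak partial derivatives `w.2 i`, normed by the maximum of the `L_∞` norms. -/
def W1inf {d : ℕ} (Ω : Opens (E d)) : Submodule ℝ (Linf Ω × (Fin d → Linf Ω)) where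
  carrier := {w | ∀ i, IsWeakPartial Ω i w.1 (w.2 i)}
  zero_mem' := by
    intro i φ
    have h0 : ((0 : Linf Ω) : E d → ℝ) =ᵐ[vol Ω] 0 := Lp.coeFn_zero _ _ _
    have h1 : ∫ x in (Ω : Set (E d)), (0 : Linf Ω) x * pderiv i φ x = 0 := by
      rw [← integral_zero (E d) ℝ (μ := vol Ω)]
      refine integral_congr_ae ?_
      filter_upwards [h0] with x hx
      rw [hx, Pi.zero_apply, zero_mul]
    have h2 : ∫ x in (Ω : Set (E d)), (0 : Linf Ω) x * φ x = 0 := by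
      rw [← integral_zero (E d) ℝ (μ := vol Ω)]
      refine integral_congr_ae ?_
      filter_upwards [h0] with x hx
      rw [hx, Pi.zero_apply, zero_mul]
    change ∫ x in (Ω : Set (E d)), (0 : Linf Ω) x * pderiv i φ x
      = - ∫ x in (Ω : Set (E d)), (0 : Linf Ω) x * φ x
    rw [h1, h2, neg_zero]
  add_mem' := by
    intro v w hv hw i φ
    have key : ∀ (f g : Linf Ω) (ψ : E d → ℝ), MemLp ψ 1 (vol Ω) →
        ∫ x in (Ω : Set (E d)), (f + g : Linf Ω) x * ψ x
          = (∫ x in (Ω : Set (E d)), f x * ψ x) + ∫ x in (Ω : Set (E d)), g x * ψ x := by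
      intro f g ψ hψ
      rw [← integral_add (integrable_mul_of_top (Lp.memLp f) hψ)
        (integrable_mul_of_top (Lp.memLp g) hψ)]
      refine integral_congr_ae ?_
      filter_upwards [Lp.coeFn_add f g] with x hx
      rw [hx, Pi.add_apply, add_mul]
    change ∫ x in (Ω : Set (E d)), (v.1 + w.1 : Linf Ω) x * pderiv i φ x
      = - ∫ x in (Ω : Set (E d)), (v.2 i + w.2 i : Linf Ω) x * φ x
    rw [key _ _ _ (memLp_pderiv 1 i φ), key _ _ _ (memLp_test 1 φ), hv i φ, hw i φ]
    ring
  smul_mem' := by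
    intro c w hw i φ
    have key : ∀ (f : Linf Ω) (ψ : E d → ℝ),
        ∫ x in (Ω : Set (E d)), (c • f : Linf Ω) x * ψ x
          = c * ∫ x in (Ω : Set (E d)), f x * ψ x := by
      intro f ψ
      rw [← integral_const_mul]
      refine integral_congr_ae ?_
      filter_upwards [Lp.coeFn_smul c f] with x hx
      rw [hx, Pi.smul_apply, smul_eq_mul, mul_assoc]
    change ∫ x in (Ω : Set (E d)), (c • w.1 : Linf Ω) x * pderiv i φ x
      = - ∫ x in (Ω : Set (E d)), (c • w.2 i : Linf Ω) x * φ x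
    rw [key, key, hw i φ]
    ring

/-- Pairs (function, gradient) in `L_2(Ω) × L_2(Ω)ᵈ`, with the norm of `H¹(Ω)`,
`‖(v, p)‖² = ‖v‖² + ∑ᵢ ‖pᵢ‖²`. -/
abbrev Pair {d : ℕ} (Ω : Opens (E d)) : Type :=
  WithLp 2 (L2 Ω × PiLp 2 (fun _ : Fin d => L2 Ω))

/-- `H¹₀(Ω)` as a subspace of the pairs: the closure of the test functions `C_c^∞(Ω)` in the norm
of `H¹(Ω)`. An element is the pair consisting of a function and its weak gradient. -/
def H10Submodule {d : ℕ} (Ω : Opens (E d)) : Submodule ℝ (Pair Ω) :=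
  (Submodule.span ℝ {w : Pair Ω | ∃ φ : TestFunction Ω ℝ ⊤,
    w.fst =ᵐ[vol Ω] φ ∧ ∀ i, w.snd i =ᵐ[vol Ω] pderiv i φ}).topologicalClosure

/-- The Hilbert space `H¹₀(Ω)`. -/
def H10 {d : ℕ} (Ω : Opens (E d)) : Type := H10Submodule Ω

instance {d : ℕ} (Ω : Opens (E d)) : NormedAddCommGroup (H10 Ω) :=
  inferInstanceAs (NormedAddCommGroup (H10Submodule Ω))

instance {d : ℕ} (Ω : Opens (E d)) : InnerProductSpace ℝ (H10 Ω) :=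
  inferInstanceAs (InnerProductSpace ℝ (H10Submodule Ω))

/-- The inclusion of `H¹₀(Ω)` into the pairs (function, gradient). -/
def toPair {d : ℕ} (Ω : Opens (E d)) : H10 Ω →L[ℝ] Pair Ω := (H10Submodule Ω).subtypeL

/-- The embedding `H¹₀(Ω) → L_2(Ω)`. -/
def val {d : ℕ} (Ω : Opens (E d)) : H10 Ω →L[ℝ] L2 Ω :=
  (WithLp.fstL 2 ℝ (L2 Ω) (PiLp 2 (fun _ : Fin d => L2 Ω))).comp (toPair Ω)

/-- The `i`-th partial derivative `H¹₀(Ω) → L_2(Ω)`. -/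
def grad {d : ℕ} (Ω : Opens (E d)) (i : Fin d) : H10 Ω →L[ℝ] L2 Ω :=
  ((PiLp.proj 2 (fun _ : Fin d => L2 Ω) i : PiLp 2 (fun _ : Fin d => L2 Ω) →L[ℝ] L2 Ω).comp
    (WithLp.sndL 2 ℝ (L2 Ω) (PiLp 2 (fun _ : Fin d => L2 Ω)))).comp (toPair Ω)

/-- Elements of `H¹₀(Ω)` satisfy the defining relation of the weak derivative. -/
lemma inner_val_pderiv {d : ℕ} {Ω : Opens (E d)} (v : H10 Ω) (i : Fin d)
    (φ : TestFunction Ω ℝ ⊤) :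
    inner ℝ ((memLp_pderiv 2 i φ).toLp _) (val Ω v)
      = - inner ℝ ((memLp_test 2 φ).toLp _) (grad Ω i v) := by
  obtain ⟨v, hv⟩ := v
  change inner ℝ ((memLp_pderiv 2 i φ).toLp _) v.fst
      = - inner ℝ ((memLp_test 2 φ).toLp _) (v.snd i)
  let A : Pair Ω →L[ℝ] ℝ :=
    (innerSL ℝ ((memLp_pderiv 2 i φ).toLp _)).comp
      (WithLp.fstL 2 ℝ (L2 Ω) (PiLp 2 (fun _ : Fin d => L2 Ω))) +
    (innerSL ℝ ((memLp_test 2 φ).toLp _)).comp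
      ((PiLp.proj 2 (fun _ : Fin d => L2 Ω) i : PiLp 2 (fun _ : Fin d => L2 Ω) →L[ℝ] L2 Ω).comp
        (WithLp.sndL 2 ℝ (L2 Ω) (PiLp 2 (fun _ : Fin d => L2 Ω))))
  have hA : ∀ w, A w = inner ℝ ((memLp_pderiv 2 i φ).toLp _) w.fst
      + inner ℝ ((memLp_test 2 φ).toLp _) (w.snd i) := fun w => rfl
  have hle : H10Submodule Ω ≤ LinearMap.ker (A : Pair Ω →ₗ[ℝ] ℝ) := by
    refine Submodule.topologicalClosure_minimal _ ?_ A.isClosed_ker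
    rw [Submodule.span_le]
    rintro w ⟨ψ, h1, h2⟩
    change A w = 0
    rw [hA, MeasureTheory.L2.inner_def, MeasureTheory.L2.inner_def]
    have e1 : ∫ x, inner ℝ ((memLp_pderiv 2 i φ).toLp _ x) (w.fst x) ∂(vol Ω)
        = ∫ x, ψ x * pderiv i φ x := by
      rw [eq_comm, ← setIntegral_eq_integral_of_forall_compl_eq_zero (s := (Ω : Set (E d)))]
      · refine integral_congr_ae ?_
        filter_upwards [h1, (memLp_pderiv 2 i φ).coeFn_toLp] with x hx hx'
        rw [hx, hx']; simp
      · intro x hx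
        rw [image_eq_zero_of_notMem_tsupport (fun h => hx (ψ.tsupport_subset h)), zero_mul]
    have e2 : ∫ x, inner ℝ ((memLp_test 2 φ).toLp _ x) (w.snd i x) ∂(vol Ω)
        = ∫ x, pderiv i ψ x * φ x := by
      rw [eq_comm, ← setIntegral_eq_integral_of_forall_compl_eq_zero (s := (Ω : Set (E d)))]
      · refine integral_congr_ae ?_
        filter_upwards [h2 i, (memLp_test 2 φ).coeFn_toLp] with x hx hx'
        rw [hx, hx']; simp [mul_comm]
      · intro x hx
        rw [image_eq_zero_of_notMem_tsupport (fun h => hx (φ.tsupport_subset h)), mul_zero]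
    rw [e1, e2]
    have hdiff : ∀ χ : TestFunction Ω ℝ ⊤, Differentiable ℝ χ := fun χ =>
      χ.contDiff.differentiable (by simp)
    have := integral_mul_fderiv_eq_neg_fderiv_mul_of_integrable (μ := (volume : Measure (E d)))
      (f := ψ) (g := φ) (v := EuclideanSpace.single i 1)
      (((continuous_pderiv i ψ).mul φ.continuous).integrable_of_hasCompactSupport
        φ.hasCompactSupport.mul_left)
      ((ψ.continuous.mul (continuous_pderiv i φ)).integrable_of_hasCompactSupport
        ψ.hasCompactSupport.mul_right)
      ((ψ.continuous.mul φ.continuous).integrable_of_hasCompactSupport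
        ψ.hasCompactSupport.mul_right)
      (fun x _ => hdiff ψ x) (fun x _ => hdiff φ x)
    have h' : ∫ x, ψ x * pderiv i φ x = - ∫ x, pderiv i ψ x * φ x := this
    rw [h']; ring
  have := hle hv
  have h0 : A v = 0 := this
  rw [hA] at h0
  linarith

/-- An element of `H¹₀(Ω)` is determined by its underlying function. -/
lemma val_injective {d : ℕ} (Ω : Opens (E d)) : Function.Injective (val Ω) := by
  rw [injective_iff_map_eq_zero]
  intro v hv
  have hg : ∀ i, grad Ω i v = 0 := by
    intro i
    have h := fun φ => inner_val_pderiv v i φ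
    simp only [hv, inner_zero_right] at h
    have h2 : ∀ᵐ x ∂(volume : Measure (E d)), x ∈ (Ω : Set (E d)) → grad Ω i v x = 0 := by
      refine Ω.isOpen.ae_eq_zero_of_integral_contDiff_smul_eq_zero ?_ ?_
      · have hm := Lp.memLp (grad Ω i v)
        rw [locallyIntegrableOn_iff Ω.isOpen.isLocallyClosed]
        intro k hk hkc
        have hk' : MemLp (grad Ω i v) 2 (volume.restrict k) :=
          hm.mono_measure (Measure.restrict_mono hk le_rfl)
        have : IsFiniteMeasure ((volume : Measure (E d)).restrict k) :=
          ⟨by rw [Measure.restrict_apply_univ]; exact hkc.measure_lt_top⟩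
        exact hk'.integrable (by norm_num)
      · intro φ h1 h2 h3
        let χ : TestFunction Ω ℝ ⊤ := ⟨φ, h1, h2, h3⟩
        have := h χ
        rw [MeasureTheory.L2.inner_def] at this
        rw [← setIntegral_eq_integral_of_forall_compl_eq_zero (s := (Ω : Set (E d)))]
        · rw [zero_eq_neg] at this
          rw [← this]
          refine integral_congr_ae ?_
          filter_upwards [(memLp_test 2 χ).coeFn_toLp] with x hx
          rw [hx, real_inner_comm]
          simp [χ]
        · intro x hx
          rw [image_eq_zero_of_notMem_tsupport (fun h => hx (h3 h)), zero_smul]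
    rw [Lp.eq_zero_iff_ae_eq_zero]
    exact (ae_restrict_iff' Ω.isOpen.measurableSet).2 h2
  apply Subtype.ext
  apply WithLp.ofLp_injective
  refine Prod.ext hv ?_
  apply PiLp.ext
  exact hg

/-! ### The operators of the fractional problem -/

/-- The coefficients `κ`, `F`, `G`, `a`, `b`; the last four depend on time. -/
structure Coeffs {d : ℕ} (Ω : Opens (E d)) where
  κ : Matrix (Fin d) (Fin d) (Linf Ω)
  F : ℝ → Fin d → W1inf Ω
  G : ℝ → Fin d → W1inf Ω
  a : ℝ → Linf Ω
  b : ℝ → Linf Ω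

/-- Multiplication `L_∞(Ω) × L_2(Ω) → L_2(Ω)`. -/
def mulL {d : ℕ} (Ω : Opens (E d)) : Linf Ω →L[ℝ] L2 Ω →L[ℝ] L2 Ω :=
  (ContinuousLinearMap.mul ℝ ℝ).holderL (vol Ω) ∞ 2 2

lemma mulL_coe {d : ℕ} {Ω : Opens (E d)} (c : Linf Ω) (v : L2 Ω) :
    mulL Ω c v =ᵐ[vol Ω] fun x => c x * v x :=
  (ContinuousLinearMap.mul ℝ ℝ).coeFn_holder c v

/-- `⟨κ∇v, ∇w⟩`, as a bounded operator `H¹₀(Ω) → H⁻¹(Ω)`. -/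
def diffusion {d : ℕ} {Ω : Opens (E d)} (κ : Matrix (Fin d) (Fin d) (Linf Ω)) :
    H10 Ω →L[ℝ] StrongDual ℝ (H10 Ω) :=
  ∑ i, ∑ j, (innerSL ℝ).bilinearComp ((mulL Ω (κ i j)).comp (grad Ω j)) (grad Ω i)

/-- `⟨F v, ∇w⟩`, as a bounded operator `L_2(Ω) → H⁻¹(Ω)`. -/
def drift {d : ℕ} {Ω : Opens (E d)} (F : Fin d → W1inf Ω) :
    L2 Ω →L[ℝ] StrongDual ℝ (H10 Ω) :=
  ∑ i, (innerSL ℝ).bilinearComp (mulL Ω (F i).1.1) (grad Ω i)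

/-- `⟨a v, w⟩`, as a bounded operator `L_2(Ω) → H⁻¹(Ω)`. -/
def reaction {d : ℕ} {Ω : Opens (E d)} (a : Linf Ω) :
    L2 Ω →L[ℝ] StrongDual ℝ (H10 Ω) :=
  (innerSL ℝ).bilinearComp (mulL Ω a) (val Ω)

lemma diffusion_apply {d : ℕ} {Ω : Opens (E d)} (κ : Matrix (Fin d) (Fin d) (Linf Ω))
    (v w : H10 Ω) :
    diffusion κ v w = ∑ i, ∑ j, inner ℝ (mulL Ω (κ i j) (grad Ω j v)) (grad Ω i w) := by
  simp [diffusion]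

lemma drift_apply {d : ℕ} {Ω : Opens (E d)} (F : Fin d → W1inf Ω) (v : L2 Ω) (w : H10 Ω) :
    drift F v w = ∑ i, inner ℝ (mulL Ω (F i).1.1 v) (grad Ω i w) := by
  simp [drift]

lemma reaction_apply {d : ℕ} {Ω : Opens (E d)} (a : Linf Ω) (v : L2 Ω) (w : H10 Ω) :
    reaction a v w = inner ℝ (mulL Ω a v) (val Ω w) := by
  simp [reaction]

/-- `⟨K₁(t)v, w⟩ = ⟨κ∇v, ∇w⟩ - ⟨F(t)v, ∇w⟩ + ⟨a(t)v, w⟩`. -/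
def K1 {d : ℕ} {Ω : Opens (E d)} (c : Coeffs Ω) (t : ℝ) : H10 Ω →L[ℝ] StrongDual ℝ (H10 Ω) :=
  diffusion c.κ - (drift (c.F t)).comp (val Ω) + (reaction (c.a t)).comp (val Ω)

/-- `⟨K₁'(t)v, w⟩ = -⟨F'(t)v, ∇w⟩ + ⟨a'(t)v, w⟩`, with the time derivatives taken on `[0,T]`. -/
def K1' {d : ℕ} {Ω : Opens (E d)} (c : Coeffs Ω) (T t : ℝ) :
    H10 Ω →L[ℝ] StrongDual ℝ (H10 Ω) :=
  -(drift (derivWithin c.F (Icc 0 T) t)).comp (val Ω)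
    + (reaction (derivWithin c.a (Icc 0 T) t)).comp (val Ω)

/-- `⟨K₂(t)v, w⟩ = ⟨b(t)v, w⟩ - ⟨G(t)v, ∇w⟩`. -/
def K2 {d : ℕ} {Ω : Opens (E d)} (c : Coeffs Ω) (t : ℝ) : L2 Ω →L[ℝ] StrongDual ℝ (H10 Ω) :=
  reaction (c.b t) - drift (c.G t)

/-- `ω_α(t) = t^(α-1) / Γ(α)`. -/
def omega (α t : ℝ) : ℝ := t ^ (α - 1) / Real.Gamma α

/-- The kernel `K(t,s) = ω_α(t-s) K₁(t) + K₂(s) - ∫_s^t ω_α(z-s) K₁'(z) dz`. -/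
def K {d : ℕ} {Ω : Opens (E d)} (c : Coeffs Ω) (α T t s : ℝ) :
    H10 Ω →L[ℝ] StrongDual ℝ (H10 Ω) :=
  omega α (t - s) • K1 c t + (K2 c s).comp (val Ω) - ∫ z in s..t, omega α (z - s) • K1' c T z

/-! ### The projected Volterra equation -/

section projected

variable {d : ℕ} {Ω : Opens (E d)} (X : Submodule ℝ (H10 Ω))

/-- The embedding `X → L_2(Ω)` of a subspace `X ⊆ H¹₀(Ω)`. -/
def valX : X →L[ℝ] L2 Ω := (val Ω).comp X.subtypeL

/-- The `L_2` inner product on `X`. -/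
def gram : LinearMap.BilinForm ℝ X :=
  (innerₗ (L2 Ω)).compl₁₂ (valX X : X →ₗ[ℝ] L2 Ω) (valX X : X →ₗ[ℝ] L2 Ω)

lemma gram_apply (v w : X) : gram X v w = inner ℝ (valX X v) (valX X w) := rfl

lemma gram_nondegenerate : (gram X).Nondegenerate := by
  have h : ∀ v : X, gram X v v = 0 → v = 0 := by
    intro v hv
    rw [gram_apply, inner_self_eq_zero] at hv
    have : val Ω v.1 = val Ω 0 := by rw [map_zero]; exact hv
    exact Subtype.ext (val_injective Ω this)
  exact ⟨fun v hv => h v (hv v), fun v hv => h v (hv v)⟩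

variable [FiniteDimensional ℝ X]

/-- The element `x` of `X` with `⟨x, w⟩ = ℓ w` for all `w ∈ X`, the brackets denoting the inner
product of `L_2(Ω)`. -/
def represent : Module.Dual ℝ X ≃ₗ[ℝ] X :=
  ((gram X).toDual (gram_nondegenerate X)).symm

lemma represent_spec (ℓ : Module.Dual ℝ X) (w : X) :
    inner ℝ (valX X (represent X ℓ)) (valX X w) = ℓ w := by
  rw [← gram_apply]
  exact LinearMap.BilinForm.apply_toDual_symm_apply (hB := gram_nondegenerate X) ℓ w

/-- The operator `K_X(t,s) : X → X`, with `⟨K_X(t,s)v, w⟩ = ⟨K(t,s)v, w⟩` for `v, w ∈ X`. -/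
def KX (c : Coeffs Ω) (α T t s : ℝ) : X →L[ℝ] X :=
  LinearMap.toContinuousLinearMap
    { toFun := fun v => represent X ((K c α T t s v.1 : H10 Ω →ₗ[ℝ] ℝ) ∘ₗ X.subtype)
      map_add' := by
        intro v w
        rw [← map_add]
        congr 1
        ext x
        simp
      map_smul' := by
        intro r v
        rw [RingHom.id_apply, ← map_smul]
        congr 1
        ext x
        simp }

lemma KX_spec (c : Coeffs Ω) (α T t s : ℝ) (v w : X) :
    inner ℝ (valX X (KX X c α T t s v)) (valX X w) = K c α T t s v.1 w.1 :=
  represent_spec X _ w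

/-- The `L_2` projection onto `X`: `⟨projX f, w⟩ = ⟨f, w⟩` for `w ∈ X`. -/
def projX (f : L2 Ω) : X := represent X (innerₗ (L2 Ω) f ∘ₗ (valX X : X →ₗ[ℝ] L2 Ω))

lemma projX_spec (f : L2 Ω) (w : X) :
    inner ℝ (valX X (projX X f)) (valX X w) = inner ℝ f (valX X w) :=
  represent_spec X _ w

/-- `f_X(t)`, the `L_2` projection onto `X` of `f(t) = u₀ + ∫₀ᵗ g(s) ds`. -/
def fX (u₀ : L2 Ω) (g : ℝ → L2 Ω) (t : ℝ) : X := projX X (u₀ + ∫ s in (0 : ℝ)..t, g s)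

/-- `u` is continuous on `[0,T]` and solves the projected Volterra equation
`u(t) + ∫₀ᵗ K_X(t,s) u(s) ds = f_X(t)` for `0 ≤ t ≤ T`. -/
structure IsSolution (c : Coeffs Ω) (α T : ℝ) (u₀ : L2 Ω) (g : ℝ → L2 Ω) (u : ℝ → X) : Prop where
  continuousOn : ContinuousOn u (Icc 0 T)
  eqn : ∀ t ∈ Icc 0 T, IntervalIntegrable (fun s => KX X c α T t s (u s)) volume 0 t ∧
    u t + ∫ s in (0 : ℝ)..t, KX X c α T t s (u s) = fX X u₀ g t

end projected

/-! ### The weighted space `C^m_α([0,T];Y)` -/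

section weighted

variable {Y : Type*} [NormedAddCommGroup Y] [NormedSpace ℝ Y]

/-- The quantities whose supremum over `0 < t ≤ T` is the seminorm `|v|_{j,α}`. -/
def weightedValues (α T : ℝ) (j : ℕ) (v : ℝ → Y) : Set ℝ :=
  (fun t : ℝ => t ^ ((j : ℝ) - α) * ‖iteratedDerivWithin j v (Ioc 0 T) t‖) '' Ioc 0 T

/-- The seminorm `|v|_{j,α} = sup_{0<t≤T} t^(j-α) ‖v^{(j)}(t)‖`. -/
def weightedSeminorm (α T : ℝ) (j : ℕ) (v : ℝ → Y) : ℝ := sSup (weightedValues α T j v)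

/-- Membership in `C^m_α([0,T];Y)`. -/
structure MemWeighted (m : ℕ) (α T : ℝ) (v : ℝ → Y) : Prop where
  continuousOn : ContinuousOn v (Icc 0 T)
  contDiffOn : ContDiffOn ℝ m v (Ioc 0 T)
  bounded : ∀ j ∈ Finset.Icc 1 m, BddAbove (weightedValues α T j v)

/-- The norm `‖v‖_{m,α} = max_{0≤t≤T} ‖v(t)‖ + ∑_{j=1}^m |v|_{j,α}`. -/
def weightedNorm (m : ℕ) (α T : ℝ) (v : ℝ → Y) : ℝ :=
  sSup ((fun t => ‖v t‖) '' Icc 0 T) + ∑ j ∈ Finset.Icc 1 m, weightedSeminorm α T j v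

end weighted

end FracPDE

end

/-!
Interchanging the order of integration turns the projected equation into
`u + B I^α u + ∫ (D u - B' I^α u) = f_X`, where `I^α` is the fractional integral and `B`, `B'`, `D`
are the compressions of `K₁`, `K₁'`, `K₂` to `X`. In a norm weighted by `exp (-μ t)` with `μ` large
the integral operator is a contraction, which gives existence, uniqueness and stability.

For the derivatives, write `I^α u (t)` as `t ^ α` times a weighted average of the dilates `u (t r)`,
`0 < r < 1`. The operator `t d/dt` commutes with such averages, so `t u'` solves an equation of the
same form, and the bounds follow by induction on the number of derivatives.
-/

noncomputable section

namespace FracPDE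

open Filter Topology

/-! ### Abstract Volterra operators -/

section volterra

variable {Y : Type*} [NormedAddCommGroup Y] {T β μ : ℝ} {V W : (ℝ → Y) → ℝ → Y}

/-- `N` bounds `u` on `[0,T]` in the supremum norm with the exponential weight `e^(-μt)`. -/
def ExpBound (T μ N : ℝ) (u : ℝ → Y) : Prop := ∀ t ∈ Icc 0 T, ‖u t‖ ≤ N * Real.exp (μ * t)

/-- A linear operator on continuous functions on `[0,T]`, small of order `β` at the origin, whose
norm with respect to the weights `e^(-μt)` decays like `μ^(-β)`. Only additivity is recorded, as
compatibility with differences. -/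
structure IsVolterra (T β : ℝ) (V : (ℝ → Y) → ℝ → Y) : Prop where
  continuousOn : ∀ u, ContinuousOn u (Icc 0 T) → ContinuousOn (V u) (Icc 0 T)
  map_sub : ∀ u v, ContinuousOn u (Icc 0 T) → ContinuousOn v (Icc 0 T) →
    ∀ t ∈ Icc 0 T, V (u - v) t = V u t - V v t
  bound : ∃ C, 0 ≤ C ∧ ∀ μ, 1 ≤ μ → ∀ u N, ContinuousOn u (Icc 0 T) → 0 ≤ N → ExpBound T μ N u →
    ∀ t ∈ Icc 0 T, ‖V u t‖ ≤ C * μ ^ (-β) * N * t ^ β * Real.exp (μ * t)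

lemma norm_exp_neg_smul [NormedSpace ℝ Y] (x : ℝ) (y : Y) :
    ‖Real.exp (-x) • y‖ = ‖y‖ / Real.exp x := by
  rw [norm_smul, Real.norm_of_nonneg (Real.exp_nonneg _), Real.exp_neg, inv_mul_eq_div]

lemma exists_norm_le_of_continuousOn {Z : Type*} [SeminormedAddCommGroup Z] {B : ℝ → Z}
    (hB : ContinuousOn B (Icc 0 T)) : ∃ b, 0 ≤ b ∧ ∀ t ∈ Icc 0 T, ‖B t‖ ≤ b := by
  obtain ⟨b, hb⟩ := isCompact_Icc.exists_bound_of_continuousOn hB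
  exact ⟨max b 0, le_max_right _ _, fun t ht => (hb t ht).trans (le_max_left _ _)⟩

namespace IsVolterra

lemma exists_contraction (hV : IsVolterra T β V) (hβ : 0 < β) :
    ∃ μ, 1 ≤ μ ∧ ∀ u N, ContinuousOn u (Icc 0 T) → 0 ≤ N → ExpBound T μ N u →
      ExpBound T μ (N / 2) (V u) := by
  obtain ⟨C, hC, hb⟩ := hV.bound
  have hlim : Tendsto (fun μ : ℝ => C * μ ^ (-β) * T ^ β) atTop (𝓝 (C * 0 * T ^ β)) :=
    ((tendsto_rpow_neg_atTop hβ).const_mul C).mul_const _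
  rw [mul_zero, zero_mul] at hlim
  obtain ⟨μ, hsmall, hμ⟩ := ((hlim.eventually_lt_const one_half_pos).and
    (eventually_ge_atTop 1)).exists
  refine ⟨μ, hμ, fun u N hu hN hbd t ht => (hb μ hμ u N hu hN hbd t ht).trans ?_⟩
  have hT : t ^ β ≤ T ^ β := Real.rpow_le_rpow ht.1 ht.2 hβ.le
  calc C * μ ^ (-β) * N * t ^ β * Real.exp (μ * t)
      = C * μ ^ (-β) * t ^ β * (N * Real.exp (μ * t)) := by ring
    _ ≤ C * μ ^ (-β) * T ^ β * (N * Real.exp (μ * t)) := by gcongr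
    _ ≤ 1 / 2 * (N * Real.exp (μ * t)) := by gcongr
    _ = N / 2 * Real.exp (μ * t) := by ring

lemma exists_norm_le_of_norm_add_le (hV : IsVolterra T β V) (hβ : 0 < β) :
    ∃ C, 1 ≤ C ∧ ∀ u N, ContinuousOn u (Icc 0 T) → (∀ t ∈ Icc 0 T, ‖u t + V u t‖ ≤ N) →
      ∀ t ∈ Icc 0 T, ‖u t‖ ≤ C * N := by
  obtain ⟨μ, hμ, hcontr⟩ := hV.exists_contraction hβ
  refine ⟨2 * Real.exp (μ * |T|), ?_, fun u N hu hN t ht => ?_⟩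
  · linarith [Real.one_le_exp (show 0 ≤ μ * |T| by positivity)]
  obtain ⟨t₀, ht₀, hmax⟩ := isCompact_Icc.exists_isMaxOn ⟨t, ht⟩
    (show ContinuousOn (fun s => ‖u s‖ / Real.exp (μ * s)) (Icc 0 T) from
      hu.norm.div (by fun_prop) fun s _ => (Real.exp_pos _).ne')
  set P := ‖u t₀‖ / Real.exp (μ * t₀)
  have hP : ExpBound T μ P u := fun s hs => (div_le_iff₀ (Real.exp_pos _)).1 (hmax hs)
  have hP0 : 0 ≤ P := by positivity
  have hu₀ : ‖u t₀‖ = P * Real.exp (μ * t₀) := (div_mul_cancel₀ _ (Real.exp_pos _).ne').symm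
  have htri : ‖u t₀‖ ≤ N + P / 2 * Real.exp (μ * t₀) :=
    (norm_le_add_norm_add (u t₀) (V u t₀)).trans
      (add_le_add (hN t₀ ht₀) (hcontr u P hu hP0 hP t₀ ht₀))
  have hexp : 1 ≤ Real.exp (μ * t₀) := Real.one_le_exp (by have := ht₀.1; positivity)
  have hPN : P ≤ 2 * N := by nlinarith
  calc ‖u t‖ ≤ P * Real.exp (μ * t) := hP t ht
    _ ≤ 2 * N * Real.exp (μ * |T|) := by
        have : 0 ≤ 2 * N := hP0.trans hPN
        have : t ≤ |T| := ht.2.trans (le_abs_self T)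
        gcongr
    _ = 2 * Real.exp (μ * |T|) * N := by ring

lemma eqOn_of_add_eq (hV : IsVolterra T β V) (hβ : 0 < β) {u v : ℝ → Y}
    (hu : ContinuousOn u (Icc 0 T)) (hv : ContinuousOn v (Icc 0 T))
    (h : ∀ t ∈ Icc 0 T, u t + V u t = v t + V v t) : EqOn u v (Icc 0 T) := by
  obtain ⟨C, -, hC⟩ := hV.exists_norm_le_of_norm_add_le hβ
  have hzero : ∀ t ∈ Icc 0 T, ‖(u - v) t + V (u - v) t‖ ≤ 0 := fun t ht => by
    rw [hV.map_sub u v hu hv t ht, Pi.sub_apply, sub_add_sub_comm, h t ht, sub_self, norm_zero]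
  intro t ht
  have := hC (u - v) 0 (hu.sub hv) hzero t ht
  rw [mul_zero] at this
  exact sub_eq_zero.1 (norm_le_zero_iff.1 this)

end IsVolterra

section existence

variable [NormedSpace ℝ Y]

/-- The function `e^(μt) v(t)`, extended from `[0,T]` to `ℝ` by freezing `v` outside `[0,T]`. It
turns the weighted norm on `[0,T]` into the supremum norm of `C([0,T]; Y)`. -/
def expExtend (hT : 0 ≤ T) (μ : ℝ) (v : C(Icc 0 T, Y)) (t : ℝ) : Y :=
  Real.exp (μ * t) • v (projIcc 0 T hT t)

lemma continuousOn_expExtend (hT : 0 ≤ T) (v : C(Icc 0 T, Y)) :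
    ContinuousOn (expExtend hT μ v) (Icc 0 T) :=
  ((by fun_prop : Continuous fun s => Real.exp (μ * s)).smul
    (v.continuous.comp continuous_projIcc)).continuousOn

lemma expBound_expExtend_sub (hT : 0 ≤ T) (v w : C(Icc 0 T, Y)) :
    ExpBound T μ (dist v w) (expExtend hT μ v - expExtend hT μ w) := fun s _ => by
  rw [Pi.sub_apply, expExtend, expExtend, ← smul_sub, norm_smul, ← dist_eq_norm,
    Real.norm_of_nonneg (Real.exp_nonneg _), mul_comm]
  gcongr
  exact ContinuousMap.dist_apply_le_dist _

/-- The fixed-point map of `u + V u = f`, in the variable `v(t) = e^(-μt) u(t)`. -/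
def picard (hV : IsVolterra T β V) (hT : 0 ≤ T) {f : ℝ → Y} (hf : ContinuousOn f (Icc 0 T)) (μ : ℝ)
    (v : C(Icc 0 T, Y)) : C(Icc 0 T, Y) where
  toFun t := Real.exp (-(μ * t)) • (f t - V (expExtend hT μ v) t)
  continuous_toFun := continuousOn_iff_continuous_domRestrict.1
    ((by fun_prop : Continuous fun s => Real.exp (-(μ * s))).continuousOn.smul
      (hf.sub (hV.continuousOn _ (continuousOn_expExtend hT v))))

lemma contractingWith_picard (hV : IsVolterra T β V) (hT : 0 ≤ T) {f : ℝ → Y}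
    (hf : ContinuousOn f (Icc 0 T))
    (hcontr : ∀ u N, ContinuousOn u (Icc 0 T) → 0 ≤ N → ExpBound T μ N u →
      ExpBound T μ (N / 2) (V u)) : ContractingWith (1 / 2 : NNReal) (picard hV hT hf μ) := by
  refine ⟨by rw [← NNReal.coe_lt_coe]; norm_num, LipschitzWith.of_dist_le_mul fun v w => ?_⟩
  rw [ContinuousMap.dist_le (by positivity)]
  rintro ⟨t, ht⟩
  have hv := continuousOn_expExtend (μ := μ) hT v
  have hw := continuousOn_expExtend (μ := μ) hT w
  have h := hcontr _ _ (hv.sub hw) dist_nonneg (expBound_expExtend_sub hT v w) t ht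
  rw [hV.map_sub _ _ hv hw t ht] at h
  change dist (Real.exp (-(μ * t)) • (f t - V (expExtend hT μ v) t))
    (Real.exp (-(μ * t)) • (f t - V (expExtend hT μ w) t)) ≤ _
  rw [dist_eq_norm, ← smul_sub, norm_exp_neg_smul, sub_sub_sub_cancel_left, norm_sub_rev,
    div_le_iff₀ (Real.exp_pos _)]
  exact h.trans_eq (by push_cast; ring)

lemma IsVolterra.exists_solution [CompleteSpace Y] (hV : IsVolterra T β V) (hβ : 0 < β)
    (hT : 0 ≤ T) {f : ℝ → Y} (hf : ContinuousOn f (Icc 0 T)) :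
    ∃ u, ContinuousOn u (Icc 0 T) ∧ ∀ t ∈ Icc 0 T, u t + V u t = f t := by
  obtain ⟨μ, -, hcontr⟩ := hV.exists_contraction hβ
  have hΦ := contractingWith_picard hV hT hf hcontr
  have : Nonempty C(Icc 0 T, Y) := ⟨0⟩
  set v := hΦ.fixedPoint
  have hfix : picard hV hT hf μ v = v := hΦ.fixedPoint_isFixedPt
  refine ⟨expExtend hT μ v, continuousOn_expExtend hT v, fun t ht => eq_sub_iff_add_eq.1 ?_⟩
  calc expExtend hT μ v t = Real.exp (μ * t) • v ⟨t, ht⟩ := by rw [expExtend, projIcc_of_mem hT ht]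
    _ = Real.exp (μ * t) • picard hV hT hf μ v ⟨t, ht⟩ := by rw [hfix]
    _ = f t - V (expExtend hT μ v) t := by
        change Real.exp (μ * t) • Real.exp (-(μ * t)) • (f t - V (expExtend hT μ v) t) = _
        rw [smul_smul, ← Real.exp_add, add_neg_cancel, Real.exp_zero, one_smul]

end existence

namespace IsVolterra

lemma add (hV : IsVolterra T β V) (hW : IsVolterra T β W) :
    IsVolterra T β fun u t => V u t + W u t where
  continuousOn u hu := (hV.continuousOn u hu).add (hW.continuousOn u hu)
  map_sub u v hu hv t ht := by
    rw [hV.map_sub u v hu hv t ht, hW.map_sub u v hu hv t ht]; abel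
  bound := by
    obtain ⟨C, hC, hCV⟩ := hV.bound
    obtain ⟨D, hD, hDW⟩ := hW.bound
    refine ⟨C + D, by positivity, fun μ hμ u N hu hN hb t ht => ?_⟩
    exact (norm_add_le_of_le (hCV μ hμ u N hu hN hb t ht) (hDW μ hμ u N hu hN hb t ht)).trans_eq
      (by ring)

lemma neg (hV : IsVolterra T β V) : IsVolterra T β fun u t => -V u t where
  continuousOn u hu := (hV.continuousOn u hu).neg
  map_sub u v hu hv t ht := by rw [hV.map_sub u v hu hv t ht]; abel
  bound := by simpa only [norm_neg] using hV.bound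

lemma sub (hV : IsVolterra T β V) (hW : IsVolterra T β W) :
    IsVolterra T β fun u t => V u t - W u t := by
  simpa only [sub_eq_add_neg] using hV.add hW.neg

lemma eqOn (hV : IsVolterra T β V) {u v : ℝ → Y} (hu : ContinuousOn u (Icc 0 T))
    (hv : ContinuousOn v (Icc 0 T)) (h : EqOn u v (Icc 0 T)) : EqOn (V u) (V v) (Icc 0 T) := by
  obtain ⟨C, -, hC⟩ := hV.bound
  intro t ht
  have hzero : ExpBound T 1 0 (u - v) := fun s hs => by simp [h hs]
  have := hC 1 le_rfl (u - v) 0 (hu.sub hv) le_rfl hzero t ht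
  rw [hV.map_sub u v hu hv t ht, mul_zero, zero_mul, zero_mul] at this
  exact sub_eq_zero.1 (norm_le_zero_iff.1 this)

lemma congr (hV : IsVolterra T β V)
    (h : ∀ u, ContinuousOn u (Icc 0 T) → EqOn (W u) (V u) (Icc 0 T)) : IsVolterra T β W where
  continuousOn u hu := (hV.continuousOn u hu).congr (h u hu)
  map_sub u v hu hv t ht := by
    rw [h _ (hu.sub hv) ht, h u hu ht, h v hv ht]
    exact hV.map_sub u v hu hv t ht
  bound := by
    obtain ⟨C, hC, hb⟩ := hV.bound
    refine ⟨C, hC, fun μ hμ u N hu hN hu' t ht => ?_⟩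
    rw [h u hu ht]
    exact hb μ hμ u N hu hN hu' t ht

lemma exists_expBound (hV : IsVolterra T β V) (hβ : 0 ≤ β) :
    ∃ C, 0 ≤ C ∧ ∀ μ, 1 ≤ μ → ∀ u N, ContinuousOn u (Icc 0 T) → 0 ≤ N → ExpBound T μ N u →
      ExpBound T μ (C * N) (V u) := by
  obtain ⟨C, hC, h⟩ := hV.bound
  refine ⟨C * |T| ^ β, by positivity, fun μ hμ u N hu hN hu' s hs => ?_⟩
  have hμ' : μ ^ (-β) ≤ 1 := Real.rpow_le_one_of_one_le_of_nonpos hμ (by linarith)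
  have hs' : s ^ β ≤ |T| ^ β := Real.rpow_le_rpow hs.1 (hs.2.trans (le_abs_self T)) hβ
  have hs0 : 0 ≤ s ^ β := Real.rpow_nonneg hs.1 β
  calc ‖V u s‖ ≤ C * μ ^ (-β) * N * s ^ β * Real.exp (μ * s) := h μ hμ u N hu hN hu' s hs
    _ ≤ C * 1 * N * |T| ^ β * Real.exp (μ * s) := by gcongr
    _ = C * |T| ^ β * N * Real.exp (μ * s) := by ring

lemma comp (hβ : 0 ≤ β) (hV : IsVolterra T β V) (hW : IsVolterra T β W) :
    IsVolterra T β fun u => V (W u) where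
  continuousOn u hu := hV.continuousOn _ (hW.continuousOn u hu)
  map_sub u v hu hv t ht := by
    have hWu := hW.continuousOn u hu
    have hWv := hW.continuousOn v hv
    rw [← hV.map_sub _ _ hWu hWv t ht]
    exact hV.eqOn (hW.continuousOn _ (hu.sub hv)) (hWu.sub hWv) (hW.map_sub u v hu hv) ht
  bound := by
    obtain ⟨C, hC, hCV⟩ := hV.bound
    obtain ⟨D, hD, hDW⟩ := hW.exists_expBound hβ
    refine ⟨C * D, by positivity, fun μ hμ u N hu hN hu' t ht => ?_⟩
    exact (hCV μ hμ _ (D * N) (hW.continuousOn u hu) (by positivity)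
      (hDW μ hμ u N hu hN hu') t ht).trans_eq (by ring)

variable [NormedSpace ℝ Y] {B : ℝ → Y →L[ℝ] Y}

lemma clm_apply (hV : IsVolterra T β V) (hB : ContinuousOn B (Icc 0 T)) :
    IsVolterra T β fun u t => B t (V u t) where
  continuousOn u hu := hB.clm_apply (hV.continuousOn u hu)
  map_sub u v hu hv t ht := by rw [hV.map_sub u v hu hv t ht, _root_.map_sub]
  bound := by
    obtain ⟨C, hC, h⟩ := hV.bound
    obtain ⟨b, hb, hBb⟩ := exists_norm_le_of_continuousOn hB
    refine ⟨b * C, by positivity, fun μ hμ u N hu hN hu' t ht => ?_⟩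
    exact ((B t).le_of_opNorm_le_of_le (hBb t ht) (h μ hμ u N hu hN hu' t ht)).trans_eq (by ring)

lemma comp_clm_apply (hV : IsVolterra T β V) (hB : ContinuousOn B (Icc 0 T)) :
    IsVolterra T β fun u t => V (fun s => B s (u s)) t where
  continuousOn u hu := hV.continuousOn _ (hB.clm_apply hu)
  map_sub u v hu hv t ht := by
    rw [← hV.map_sub _ _ (hB.clm_apply hu) (hB.clm_apply hv) t ht]
    congr 1
    ext s
    exact _root_.map_sub (B s) (u s) (v s)
  bound := by
    obtain ⟨C, hC, h⟩ := hV.bound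
    obtain ⟨b, hb, hBb⟩ := exists_norm_le_of_continuousOn hB
    refine ⟨C * b, by positivity, fun μ hμ u N hu hN hu' t ht => ?_⟩
    have hBu : ExpBound T μ (b * N) fun s => B s (u s) := fun s hs =>
      ((B s).le_of_opNorm_le_of_le (hBb s hs) (hu' s hs)).trans_eq (by ring)
    exact (h μ hμ _ (b * N) (hB.clm_apply hu) (by positivity) hBu t ht).trans_eq (by ring)

end IsVolterra

end volterra

/-! ### Primitives of integrands with an algebraic singularity at the origin -/

section primitive

variable {Y : Type*} [NormedAddCommGroup Y] {T A β t : ℝ} {f g : ℝ → Y}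

lemma intervalIntegrable_of_norm_le_rpow (hβ : -1 < β) (hg : ContinuousOn g (Ioc 0 T))
    (hb : ∀ t ∈ Ioc 0 T, ‖g t‖ ≤ A * t ^ β) (ht : t ∈ Icc 0 T) :
    IntervalIntegrable g volume 0 t := by
  have hsub : Ioc 0 t ⊆ Ioc 0 T := Ioc_subset_Ioc_right ht.2
  refine ((intervalIntegral.intervalIntegrable_rpow' hβ).const_mul A).mono_fun' ?_ ?_
  · rw [uIoc_of_le ht.1]
    exact (hg.mono hsub).aestronglyMeasurable measurableSet_Ioc
  · rw [uIoc_of_le ht.1]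
    filter_upwards [ae_restrict_mem measurableSet_Ioc] with s hs using hb s (hsub hs)

variable [NormedSpace ℝ Y]

lemma norm_primitive_le (hβ : -1 < β) (hb : ∀ t ∈ Ioc 0 T, ‖g t‖ ≤ A * t ^ β)
    (ht : t ∈ Icc 0 T) : ‖∫ s in (0 : ℝ)..t, g s‖ ≤ A * (t ^ (β + 1) / (β + 1)) := by
  refine (intervalIntegral.norm_integral_le_of_norm_le ht.1
    (ae_of_all _ fun s hs => hb s ⟨hs.1, hs.2.trans ht.2⟩)
    ((intervalIntegral.intervalIntegrable_rpow' hβ).const_mul A)).trans_eq ?_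
  rw [intervalIntegral.integral_const_mul, integral_rpow (Or.inl hβ),
    Real.zero_rpow (by linarith), sub_zero]

lemma continuousOn_primitive_of_norm_le_rpow (hβ : -1 < β) (hg : ContinuousOn g (Ioc 0 T))
    (hb : ∀ t ∈ Ioc 0 T, ‖g t‖ ≤ A * t ^ β) :
    ContinuousOn (fun t => ∫ s in (0 : ℝ)..t, g s) (Icc 0 T) := by
  rcases lt_or_ge T 0 with hT | hT
  · simp [Icc_eq_empty hT.not_ge]
  have hint := intervalIntegrable_of_norm_le_rpow hβ hg hb ⟨hT, le_rfl⟩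
  rw [intervalIntegrable_iff'] at hint
  simpa only [uIcc_of_le hT] using intervalIntegral.continuousOn_primitive_interval hint

variable [CompleteSpace Y]

lemma hasDerivWithinAt_primitive (hβ : -1 < β) (hg : ContinuousOn g (Ioc 0 T))
    (hb : ∀ t ∈ Ioc 0 T, ‖g t‖ ≤ A * t ^ β) (ht : t ∈ Ioc 0 T) :
    HasDerivWithinAt (fun t => ∫ s in (0 : ℝ)..t, g s) (g t) (Ioc 0 T) t := by
  have hsub : Icc (t / 2) T ⊆ Ioc 0 T := fun s hs => ⟨(half_pos ht.1).trans_le hs.1, hs.2⟩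
  have htmem : t ∈ Icc (t / 2) T := ⟨half_le_self ht.1.le, ht.2⟩
  have : Fact (t ∈ Icc (t / 2) T) := ⟨htmem⟩
  have hderiv : HasDerivWithinAt (fun t => ∫ s in (0 : ℝ)..t, g s) (g t) (Icc (t / 2) T) t :=
    intervalIntegral.integral_hasDerivWithinAt_right
      (intervalIntegrable_of_norm_le_rpow hβ hg hb ⟨ht.1.le, ht.2⟩)
      ((hg.mono hsub).stronglyMeasurableAtFilter_nhdsWithin measurableSet_Icc t)
      (hg.mono hsub t htmem)
  refine hderiv.mono_of_mem_nhdsWithin ?_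
  filter_upwards [self_mem_nhdsWithin, mem_nhdsWithin_of_mem_nhds
    (Ioi_mem_nhds (half_lt_self ht.1))] with s hs hs' using ⟨le_of_lt hs', hs.2⟩

lemma integral_eq_sub_of_hasDerivWithinAt (hβ : -1 < β) (hf : ContinuousOn f (Icc 0 T))
    (hg : ContinuousOn g (Ioc 0 T)) (hb : ∀ t ∈ Ioc 0 T, ‖g t‖ ≤ A * t ^ β)
    (hfg : ∀ t ∈ Ioc 0 T, HasDerivWithinAt f (g t) (Ioc 0 T) t) (ht : t ∈ Icc 0 T) :
    ∫ s in (0 : ℝ)..t, g s = f t - f 0 :=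
  intervalIntegral.integral_eq_sub_of_hasDerivAt_of_le ht.1 (hf.mono (Icc_subset_Icc_right ht.2))
    (fun s hs => (hfg s ⟨hs.1, hs.2.le.trans ht.2⟩).hasDerivAt
      (Ioc_mem_nhds hs.1 (hs.2.trans_le ht.2)))
    (intervalIntegrable_of_norm_le_rpow hβ hg hb ht)

end primitive

namespace IsVolterra

variable {Y : Type*} [NormedAddCommGroup Y] [NormedSpace ℝ Y] {T β μ N : ℝ}
  {V : (ℝ → Y) → ℝ → Y} {u : ℝ → Y}

lemma continuousOn_inv_smul (hV : IsVolterra T β V) (hu : ContinuousOn u (Icc 0 T)) :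
    ContinuousOn (fun s => s⁻¹ • V u s) (Ioc 0 T) :=
  (continuousOn_id.inv₀ fun _ hs => hs.1.ne').smul ((hV.continuousOn u hu).mono Ioc_subset_Icc_self)

lemma exists_norm_inv_smul_le (hV : IsVolterra T β V) :
    ∃ C, 0 ≤ C ∧ ∀ μ, 1 ≤ μ → ∀ u N, ContinuousOn u (Icc 0 T) → 0 ≤ N → ExpBound T μ N u →
      ∀ t ∈ Icc 0 T, ∀ s ∈ Ioc 0 t,
        ‖s⁻¹ • V u s‖ ≤ C * μ ^ (-β) * N * Real.exp (μ * t) * s ^ (β - 1) := by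
  obtain ⟨C, hC, h⟩ := hV.bound
  refine ⟨C, hC, fun μ hμ u N hu hN hb t ht s ⟨hs0, hst⟩ => ?_⟩
  rw [norm_smul, norm_inv, Real.norm_of_nonneg hs0.le, Real.rpow_sub_one hs0.ne']
  calc s⁻¹ * ‖V u s‖ ≤ s⁻¹ * (C * μ ^ (-β) * N * s ^ β * Real.exp (μ * s)) := by
        gcongr
        exact h μ hμ u N hu hN hb s ⟨hs0.le, hst.trans ht.2⟩
    _ ≤ s⁻¹ * (C * μ ^ (-β) * N * s ^ β * Real.exp (μ * t)) := by gcongr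
    _ = C * μ ^ (-β) * N * Real.exp (μ * t) * (s ^ β / s) := by ring

lemma exists_norm_inv_smul_le_rpow (hV : IsVolterra T β V) (hu : ContinuousOn u (Icc 0 T)) :
    ∃ A, ∀ s ∈ Ioc 0 T, ‖s⁻¹ • V u s‖ ≤ A * s ^ (β - 1) := by
  obtain ⟨C, -, h⟩ := hV.exists_norm_inv_smul_le
  obtain ⟨b, hb0, hb⟩ := exists_norm_le_of_continuousOn hu
  refine ⟨_, fun s hs => h 1 le_rfl u b hu hb0 (fun s hs => (hb s hs).trans ?_) T
    ⟨(hs.1.trans_le hs.2).le, le_rfl⟩ s hs⟩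
  exact le_mul_of_one_le_right hb0 (Real.one_le_exp (by simpa using hs.1))

lemma integral_inv_smul (hβ : 0 < β) (hV : IsVolterra T β V) :
    IsVolterra T β fun u t => ∫ s in (0 : ℝ)..t, s⁻¹ • V u s where
  continuousOn u hu := by
    obtain ⟨A, hA⟩ := hV.exists_norm_inv_smul_le_rpow hu
    exact continuousOn_primitive_of_norm_le_rpow (by linarith) (hV.continuousOn_inv_smul hu) hA
  map_sub u v hu hv t ht := by
    have hint : ∀ {u}, ContinuousOn u (Icc 0 T) →
        IntervalIntegrable (fun s => s⁻¹ • V u s) volume 0 t := fun hu => by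
      obtain ⟨A, hA⟩ := hV.exists_norm_inv_smul_le_rpow hu
      exact intervalIntegrable_of_norm_le_rpow (by linarith) (hV.continuousOn_inv_smul hu) hA ht
    rw [← intervalIntegral.integral_sub (hint hu) (hint hv)]
    refine intervalIntegral.integral_congr fun s hs => ?_
    rw [uIcc_of_le ht.1] at hs
    simp only [hV.map_sub u v hu hv s ⟨hs.1, hs.2.trans ht.2⟩, smul_sub]
  bound := by
    obtain ⟨C, hC, h⟩ := hV.exists_norm_inv_smul_le
    refine ⟨C / β, by positivity, fun μ hμ u N hu hN hb t ht => ?_⟩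
    refine (norm_primitive_le (by linarith) (h μ hμ u N hu hN hb t ht)
      ⟨ht.1, le_rfl⟩).trans_eq ?_
    rw [sub_add_cancel]
    ring

end IsVolterra

/-! ### Fractional integrals as averages over dilations -/

section dilation

variable {Y : Type*} [NormedAddCommGroup Y] [NormedSpace ℝ Y] {T t σ b : ℝ} {u w : ℝ → Y}

lemma mul_mem_Icc (ht : t ∈ Icc 0 T) (hσ : σ ∈ Icc (0 : ℝ) 1) : t * σ ∈ Icc 0 T :=
  ⟨mul_nonneg ht.1 hσ.1, (mul_le_of_le_one_right ht.1 hσ.2).trans ht.2⟩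

lemma mul_mem_Ioc (ht : t ∈ Ioc 0 T) (hσ : σ ∈ Ioc (0 : ℝ) 1) : t * σ ∈ Ioc 0 T :=
  ⟨mul_pos ht.1 hσ.1, (mul_le_of_le_one_right ht.1.le hσ.2).trans ht.2⟩

lemma hasDerivWithinAt_comp_mul_right
    (hu : ∀ t ∈ Ioc 0 T, HasDerivWithinAt u (t⁻¹ • w t) (Ioc 0 T) t) (ht : t ∈ Ioc 0 T)
    (hσ : σ ∈ Ioc (0 : ℝ) 1) :
    HasDerivWithinAt (fun y => u (y * σ)) (t⁻¹ • w (t * σ)) (Ioc 0 T) t := by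
  have hchain := (hu (t * σ) (mul_mem_Ioc ht hσ)).scomp t
    ((hasDerivAt_id t).mul_const σ).hasDerivWithinAt (fun y hy => mul_mem_Ioc hy hσ)
  refine hchain.congr_deriv ?_
  rw [smul_smul, one_mul, mul_inv, mul_left_comm, mul_inv_cancel₀ hσ.1.ne', mul_one]

lemma norm_comp_mul_right_sub_le
    (hu : ∀ t ∈ Ioc 0 T, HasDerivWithinAt u (t⁻¹ • w t) (Ioc 0 T) t)
    (hw : ∀ t ∈ Icc 0 T, ‖w t‖ ≤ b) (ht : t ∈ Ioc 0 T) {y : ℝ} (hy : y ∈ Ioc 0 T)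
    (hty : t / 2 ≤ y) (hσ : σ ∈ Ioc (0 : ℝ) 1) :
    ‖u (y * σ) - u (t * σ)‖ ≤ 2 * b / t * ‖y - t‖ := by
  have hsub : Icc (t / 2) T ⊆ Ioc 0 T := fun s hs => ⟨(half_pos ht.1).trans_le hs.1, hs.2⟩
  have hderiv_le : ∀ s ∈ Icc (t / 2) T, ‖s⁻¹ • w (s * σ)‖ ≤ 2 * b / t := fun s hs => by
    have hs' := hsub hs
    have hwb := hw _ (Ioc_subset_Icc_self (mul_mem_Ioc hs' hσ))
    rw [norm_smul, norm_inv, Real.norm_of_nonneg hs'.1.le]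
    calc s⁻¹ * ‖w (s * σ)‖ ≤ (t / 2)⁻¹ * b := by
          have := half_pos ht.1
          have := hs.1
          gcongr
      _ = 2 * b / t := by rw [inv_div, div_mul_eq_mul_div]
  exact (convex_Icc (t / 2) T).norm_image_sub_le_of_norm_hasDerivWithin_le
    (fun s hs => (hasDerivWithinAt_comp_mul_right hu (hsub hs) hσ).mono hsub) hderiv_le
    ⟨half_le_self ht.1.le, ht.2⟩ ⟨hty, hy.2⟩

lemma hasDerivWithinAt_intervalIntegral_of_lipschitz {f : ℝ → ℝ → Y} {f' : ℝ → Y} {bound : ℝ → ℝ}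
    {a b : ℝ} {s : Set ℝ} (ht : t ∈ s) (hint : ∀ y ∈ s, IntervalIntegrable (f y) volume a b)
    (hbound : IntervalIntegrable bound volume a b)
    (hlip : ∀ᶠ y in 𝓝[s] t, ∀ σ ∈ uIoc a b, ‖f y σ - f t σ‖ ≤ bound σ * ‖y - t‖)
    (hderiv : ∀ σ ∈ uIoc a b, HasDerivWithinAt (fun y => f y σ) (f' σ) s t) :
    HasDerivWithinAt (fun y => ∫ σ in a..b, f y σ) (∫ σ in a..b, f' σ) s t := by
  have hsub : 𝓝[s \ {t}] t ≤ 𝓝[s] t := nhdsWithin_mono t sdiff_subset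
  have hslope : Tendsto (fun y => ∫ σ in a..b, (y - t)⁻¹ • (f y σ - f t σ)) (𝓝[s \ {t}] t)
      (𝓝 (∫ σ in a..b, f' σ)) := by
    refine intervalIntegral.tendsto_integral_filter_of_dominated_convergence bound ?_ ?_ hbound ?_
    · filter_upwards [self_mem_nhdsWithin] with y hy
      exact (((hint y hy.1).sub (hint t ht)).smul _).def'.aestronglyMeasurable
    · filter_upwards [self_mem_nhdsWithin, hsub hlip] with y hy hlip_y
      refine ae_of_all _ fun σ hσ => ?_
      rw [norm_smul, norm_inv, inv_mul_le_iff₀ (norm_pos_iff.2 (sub_ne_zero.2 hy.2)), mul_comm]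
      exact hlip_y σ hσ
    · exact ae_of_all _ fun σ hσ => hasDerivWithinAt_iff_tendsto_slope.1 (hderiv σ hσ)
  refine hasDerivWithinAt_iff_tendsto_slope.2 (hslope.congr' ?_)
  filter_upwards [self_mem_nhdsWithin] with y hy
  rw [intervalIntegral.integral_smul, intervalIntegral.integral_sub (hint y hy.1) (hint t ht)]
  rfl

end dilation

section omega

variable {γ t : ℝ}

lemma omega_nonneg (hγ : 0 < γ) (ht : 0 ≤ t) : 0 ≤ omega γ t :=
  div_nonneg (Real.rpow_nonneg ht _) (Real.Gamma_pos_of_pos hγ).le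

lemma norm_omega_smul_le {Y : Type*} [NormedAddCommGroup Y] [NormedSpace ℝ Y] (hγ : 0 < γ)
    (ht : 0 ≤ t) {y : Y} {b : ℝ} (hy : ‖y‖ ≤ b) : ‖omega γ t • y‖ ≤ omega γ t * b := by
  have := omega_nonneg hγ ht
  rw [norm_smul, Real.norm_of_nonneg this]
  gcongr

lemma intervalIntegrable_omega_sub (hγ : 0 < γ) (a b c : ℝ) :
    IntervalIntegrable (fun s => omega γ (c - s)) volume a b := by
  have hrpow := (intervalIntegral.intervalIntegrable_rpow' (a := c - a) (b := c - b)
    (by linarith : -1 < γ - 1)).div_const (Real.Gamma γ)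
  simpa [omega] using hrpow.comp_sub_left c

lemma intervalIntegrable_omega_mul_rpow_neg {β : ℝ} (hγ : β < γ) :
    IntervalIntegrable (fun σ : ℝ => omega γ (1 - σ) * (1 - σ) ^ (-β)) volume 0 1 := by
  have hrpow := ((intervalIntegral.intervalIntegrable_rpow' (a := 1) (b := 0)
    (by linarith : -1 < γ - 1 - β)).div_const (Real.Gamma γ)).comp_sub_left 1
  rw [sub_self, sub_zero] at hrpow
  refine hrpow.congr_ae ?_
  rw [uIoc_of_le zero_le_one, ← restrict_Ioo_eq_restrict_Ioc]
  filter_upwards [ae_restrict_mem measurableSet_Ioo] with σ hσ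
  rw [omega, div_mul_eq_mul_div, ← Real.rpow_add (sub_pos.2 hσ.2), ← sub_eq_add_neg]

lemma integral_omega_one_sub_nonneg (hγ : 0 < γ) : 0 ≤ ∫ σ in (0 : ℝ)..1, omega γ (1 - σ) :=
  intervalIntegral.integral_nonneg zero_le_one fun _ hσ => omega_nonneg hγ (sub_nonneg.2 hσ.2)

end omega

section frac

variable {Y : Type*} [NormedAddCommGroup Y] [NormedSpace ℝ Y] {T γ t A : ℝ} {u v w : ℝ → Y}

/-- The weighted average `∫₀¹ ω_γ(1-σ) u(tσ) dσ` of the dilations of `u`. -/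
def fracMean (γ : ℝ) (u : ℝ → Y) (t : ℝ) : Y :=
  ∫ σ in (0 : ℝ)..1, omega γ (1 - σ) • u (t * σ)

/-- The fractional integral `I^γ u` of order `γ`. The scaled form `t^γ ∫₀¹ ω_γ(1-σ) u(tσ) dσ` of
the convolution with `ω_γ` is chosen because the integral commutes with `t d/dt`. -/
def frac (γ : ℝ) (u : ℝ → Y) (t : ℝ) : Y := t ^ γ • fracMean γ u t

lemma intervalIntegrable_omega_smul_comp_mul (hγ : 0 < γ) (hu : ContinuousOn u (Icc 0 T))
    (ht : t ∈ Icc 0 T) :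
    IntervalIntegrable (fun σ => omega γ (1 - σ) • u (t * σ)) volume 0 1 := by
  refine (intervalIntegrable_omega_sub hγ 0 1 1).smul_continuousOn ?_
  rw [uIcc_of_le zero_le_one]
  exact hu.comp (by fun_prop) fun σ hσ => mul_mem_Icc ht hσ

lemma norm_fracMean_le (hγ : 0 < γ) (ht : t ∈ Icc 0 T) (hA : ∀ s ∈ Icc 0 T, ‖u s‖ ≤ A) :
    ‖fracMean γ u t‖ ≤ (∫ σ in (0 : ℝ)..1, omega γ (1 - σ)) * A := by
  rw [← intervalIntegral.integral_mul_const]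
  exact intervalIntegral.norm_integral_le_of_norm_le zero_le_one
    (ae_of_all _ fun σ hσ => norm_omega_smul_le hγ (sub_nonneg.2 hσ.2)
      (hA _ (mul_mem_Icc ht (Ioc_subset_Icc_self hσ))))
    ((intervalIntegrable_omega_sub hγ 0 1 1).mul_const A)

lemma continuousOn_fracMean (hγ : 0 < γ) (hu : ContinuousOn u (Icc 0 T)) :
    ContinuousOn (fracMean γ u) (Icc 0 T) := by
  obtain ⟨b, -, hb⟩ := exists_norm_le_of_continuousOn hu
  intro t ht
  refine intervalIntegral.continuousWithinAt_of_dominated_interval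
    (bound := fun σ => omega γ (1 - σ) * b) ?_ ?_
    ((intervalIntegrable_omega_sub hγ 0 1 1).mul_const b) ?_
  · filter_upwards [self_mem_nhdsWithin] with y hy
    exact (intervalIntegrable_omega_smul_comp_mul hγ hu hy).def'.aestronglyMeasurable
  · filter_upwards [self_mem_nhdsWithin] with y hy
    refine ae_of_all _ fun σ hσ => ?_
    rw [uIoc_of_le zero_le_one] at hσ
    exact norm_omega_smul_le hγ (sub_nonneg.2 hσ.2)
      (hb _ (mul_mem_Icc hy (Ioc_subset_Icc_self hσ)))
  · refine ae_of_all _ fun σ hσ => ?_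
    rw [uIoc_of_le zero_le_one] at hσ
    exact ((hu.comp (continuousOn_id.mul_const σ) fun y hy =>
      mul_mem_Icc hy (Ioc_subset_Icc_self hσ)).const_smul (omega γ (1 - σ))) t ht

lemma fracMean_sub (hγ : 0 < γ) (hu : ContinuousOn u (Icc 0 T)) (hv : ContinuousOn v (Icc 0 T))
    (ht : t ∈ Icc 0 T) : fracMean γ (u - v) t = fracMean γ u t - fracMean γ v t := by
  rw [fracMean, fracMean, fracMean, ← intervalIntegral.integral_sub
    (intervalIntegrable_omega_smul_comp_mul hγ hu ht)
    (intervalIntegrable_omega_smul_comp_mul hγ hv ht)]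
  simp only [Pi.sub_apply, smul_sub]

lemma hasDerivWithinAt_fracMean (hγ : 0 < γ) (hu : ContinuousOn u (Icc 0 T))
    (hw : ContinuousOn w (Icc 0 T))
    (huw : ∀ t ∈ Ioc 0 T, HasDerivWithinAt u (t⁻¹ • w t) (Ioc 0 T) t) (ht : t ∈ Ioc 0 T) :
    HasDerivWithinAt (fracMean γ u) (t⁻¹ • fracMean γ w t) (Ioc 0 T) t := by
  obtain ⟨b, -, hb⟩ := exists_norm_le_of_continuousOn hw
  have hderiv := hasDerivWithinAt_intervalIntegral_of_lipschitz (a := 0) (b := 1)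
    (f := fun y σ => omega γ (1 - σ) • u (y * σ))
    (f' := fun σ => t⁻¹ • (omega γ (1 - σ) • w (t * σ)))
    (bound := fun σ => omega γ (1 - σ) * (2 * b / t)) ht
    (fun y hy => intervalIntegrable_omega_smul_comp_mul hγ hu (Ioc_subset_Icc_self hy))
    ((intervalIntegrable_omega_sub hγ 0 1 1).mul_const _) ?_ ?_
  · rwa [intervalIntegral.integral_smul] at hderiv
  · filter_upwards [self_mem_nhdsWithin, mem_nhdsWithin_of_mem_nhds
      (Ioi_mem_nhds (half_lt_self ht.1))] with y hy hty σ hσ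
    rw [uIoc_of_le zero_le_one] at hσ
    rw [← smul_sub, mul_assoc]
    exact norm_omega_smul_le hγ (sub_nonneg.2 hσ.2)
      (norm_comp_mul_right_sub_le huw hb ht hy (le_of_lt hty) hσ)
  · intro σ hσ
    rw [uIoc_of_le zero_le_one] at hσ
    rw [smul_comm]
    exact (hasDerivWithinAt_comp_mul_right huw ht hσ).const_smul _

lemma frac_zero (hγ : γ ≠ 0) : frac γ u 0 = 0 := by rw [frac, Real.zero_rpow hγ, zero_smul]

lemma frac_eq_integral (hγ : 0 < γ) (ht : 0 ≤ t) :
    frac γ u t = ∫ s in (0 : ℝ)..t, omega γ (t - s) • u s := by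
  rcases ht.eq_or_lt with rfl | ht
  · rw [frac_zero hγ.ne', intervalIntegral.integral_same]
  have hscale := intervalIntegral.smul_integral_comp_mul_left (a := 0) (b := 1)
    (fun s => omega γ (t - s) • u s) t
  rw [mul_zero, mul_one] at hscale
  rw [← hscale, frac, fracMean, ← intervalIntegral.integral_smul, ← intervalIntegral.integral_smul]
  refine intervalIntegral.integral_congr fun σ hσ => ?_
  rw [uIcc_of_le zero_le_one] at hσ
  simp only [smul_smul]
  congr 1
  rw [omega, omega, ← mul_one_sub, Real.mul_rpow ht.le (sub_nonneg.2 hσ.2),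
    Real.rpow_sub_one ht.ne']
  field_simp

lemma frac_one (ht : 0 ≤ t) : frac 1 u t = ∫ s in (0 : ℝ)..t, u s := by
  rw [frac_eq_integral one_pos ht]
  simp [omega]

lemma continuousOn_frac (hγ : 0 < γ) (hu : ContinuousOn u (Icc 0 T)) :
    ContinuousOn (frac γ u) (Icc 0 T) :=
  (Real.continuous_rpow_const hγ.le).continuousOn.smul (continuousOn_fracMean hγ hu)

lemma norm_frac_le (hγ : 0 < γ) (ht : t ∈ Icc 0 T) (hA : ∀ s ∈ Icc 0 T, ‖u s‖ ≤ A) :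
    ‖frac γ u t‖ ≤ (∫ σ in (0 : ℝ)..1, omega γ (1 - σ)) * A * t ^ γ := by
  have hrpow := Real.rpow_nonneg ht.1 γ
  rw [frac, norm_smul, Real.norm_of_nonneg hrpow, mul_comm]
  exact mul_le_mul_of_nonneg_right (norm_fracMean_le hγ ht hA) hrpow

lemma hasDerivWithinAt_frac (hγ : 0 < γ) (hu : ContinuousOn u (Icc 0 T))
    (hw : ContinuousOn w (Icc 0 T))
    (huw : ∀ t ∈ Ioc 0 T, HasDerivWithinAt u (t⁻¹ • w t) (Ioc 0 T) t) (ht : t ∈ Ioc 0 T) :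
    HasDerivWithinAt (frac γ u) (t⁻¹ • (γ • frac γ u t + frac γ w t)) (Ioc 0 T) t := by
  have hprod := (Real.hasDerivAt_rpow_const (p := γ) (Or.inl ht.1.ne')).hasDerivWithinAt.smul
    (hasDerivWithinAt_fracMean hγ hu hw huw ht)
  refine hprod.congr_deriv ?_
  rw [frac, frac, Real.rpow_sub_one ht.1.ne', smul_add, add_comm]
  simp only [smul_smul]
  congr 2 <;> ring

lemma exp_neg_le_rpow_neg {x p : ℝ} (hx : 0 < x) (hp0 : 0 ≤ p) (hp1 : p ≤ 1) :
    Real.exp (-x) ≤ x ^ (-p) := by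
  rw [Real.rpow_neg hx.le, Real.exp_neg]
  gcongr
  calc x ^ p ≤ 1 + p * (x - 1) := by
        simpa using rpow_one_add_le_one_add_mul_self (by linarith : -1 ≤ x - 1) hp0 hp1
    _ ≤ x + 1 := by nlinarith
    _ ≤ Real.exp x := Real.add_one_le_exp x

variable {β μ N : ℝ}

lemma norm_fracMean_le_of_expBound (hβ : β ∈ Icc 0 1) (hβγ : β < γ) (hμ : 0 < μ)
    (hN : 0 ≤ N) (hu : ExpBound T μ N u) (ht : t ∈ Ioc 0 T) :
    ‖fracMean γ u t‖ ≤ (∫ σ in (0 : ℝ)..1, omega γ (1 - σ) * (1 - σ) ^ (-β)) *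
      ((μ * t) ^ (-β) * N * Real.exp (μ * t)) := by
  rw [← intervalIntegral.integral_mul_const]
  refine intervalIntegral.norm_integral_le_of_norm_le zero_le_one ?_
    ((intervalIntegrable_omega_mul_rpow_neg hβγ).mul_const _)
  filter_upwards [compl_mem_ae_iff.2 (measure_singleton (1 : ℝ))] with σ hσ1 hσ
  have hσ' : 0 < 1 - σ := sub_pos.2 (lt_of_le_of_ne hσ.2 hσ1)
  have ht0 := ht.1
  rw [mul_assoc]
  refine norm_omega_smul_le (hβ.1.trans_lt hβγ) hσ'.le ?_
  calc ‖u (t * σ)‖ ≤ N * Real.exp (μ * (t * σ)) :=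
        hu _ (Ioc_subset_Icc_self (mul_mem_Ioc ht hσ))
    _ = N * Real.exp (μ * t) * Real.exp (-(μ * t * (1 - σ))) := by
        rw [mul_assoc, ← Real.exp_add]; ring_nf
    _ ≤ N * Real.exp (μ * t) * (μ * t * (1 - σ)) ^ (-β) := by
        gcongr
        exact exp_neg_le_rpow_neg (by positivity) hβ.1 hβ.2
    _ = (1 - σ) ^ (-β) * ((μ * t) ^ (-β) * N * Real.exp (μ * t)) := by
        rw [Real.mul_rpow (by positivity) hσ'.le]; ring

lemma isVolterra_frac (hβ0 : 0 < β) (hβ1 : β ≤ 1) (hγ : 2 * β ≤ γ) :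
    IsVolterra T β (frac γ : (ℝ → Y) → ℝ → Y) where
  continuousOn u hu := continuousOn_frac (by linarith) hu
  map_sub u v hu hv t ht := by
    rw [frac, fracMean_sub (by linarith) hu hv ht, smul_sub]; rfl
  bound := by
    have hγ0 : 0 < γ := by linarith
    set I := ∫ σ in (0 : ℝ)..1, omega γ (1 - σ) * (1 - σ) ^ (-β)
    have hI : 0 ≤ I := intervalIntegral.integral_nonneg zero_le_one fun σ hσ =>
      mul_nonneg (omega_nonneg hγ0 (sub_nonneg.2 hσ.2)) (Real.rpow_nonneg (sub_nonneg.2 hσ.2) _)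
    refine ⟨I * |T| ^ (γ - 2 * β), by positivity, fun μ hμ u N _ hN hb t ht => ?_⟩
    have hμ0 : 0 < μ := by linarith
    rcases ht.1.eq_or_lt with rfl | ht0
    · simp [frac_zero hγ0.ne', Real.zero_rpow hβ0.ne']
    have hmean := norm_fracMean_le_of_expBound ⟨hβ0.le, hβ1⟩ (by linarith : β < γ) hμ0 hN hb
      ⟨ht0, ht.2⟩
    have hsplit : t ^ γ * t ^ (-β) = t ^ (γ - 2 * β) * t ^ β := by
      rw [← Real.rpow_add ht0, ← Real.rpow_add ht0]; ring_nf
    have hT : t ^ (γ - 2 * β) ≤ |T| ^ (γ - 2 * β) :=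
      Real.rpow_le_rpow ht.1 (ht.2.trans (le_abs_self T)) (by linarith)
    rw [frac, norm_smul, Real.norm_of_nonneg (Real.rpow_nonneg ht.1 _)]
    calc t ^ γ * ‖fracMean γ u t‖
        ≤ t ^ γ * (I * ((μ * t) ^ (-β) * N * Real.exp (μ * t))) := by gcongr
      _ = t ^ γ * t ^ (-β) * (I * μ ^ (-β) * N * Real.exp (μ * t)) := by
          rw [Real.mul_rpow hμ0.le ht.1]; ring
      _ = t ^ (γ - 2 * β) * (I * μ ^ (-β) * N * t ^ β * Real.exp (μ * t)) := by
          rw [hsplit]; ring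
      _ ≤ |T| ^ (γ - 2 * β) * (I * μ ^ (-β) * N * t ^ β * Real.exp (μ * t)) := by gcongr
      _ = I * |T| ^ (γ - 2 * β) * μ ^ (-β) * N * t ^ β * Real.exp (μ * t) := by ring

end frac

/-! ### Weighted bounds on derivatives -/

section derivBound

variable {Y Z W : Type*} [NormedAddCommGroup Y] [NormedSpace ℝ Y] [NormedAddCommGroup Z]
  [NormedSpace ℝ Z] [NormedAddCommGroup W] [NormedSpace ℝ W]
  {T α β : ℝ} {k : ℕ} {v v' : ℝ → Y} {A : ℝ}

lemma contDiffOn_succ_of_hasDerivWithinAt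
    (hv : ∀ t ∈ Ioc 0 T, HasDerivWithinAt v (v' t) (Ioc 0 T) t)
    (hv' : ContDiffOn ℝ k v' (Ioc 0 T)) : ContDiffOn ℝ (k + 1 : ℕ) v (Ioc 0 T) := by
  have hu := uniqueDiffOn_Ioc (0 : ℝ) T
  push_cast
  exact (contDiffOn_succ_iff_derivWithin hu).2 ⟨fun t ht => (hv t ht).differentiableWithinAt,
    by simp, hv'.congr fun t ht => (hv t ht).derivWithin (hu t ht)⟩

lemma iteratedDerivWithin_succ_of_hasDerivWithinAt
    (hv : ∀ t ∈ Ioc 0 T, HasDerivWithinAt v (v' t) (Ioc 0 T) t) (j : ℕ) {t : ℝ}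
    (ht : t ∈ Ioc 0 T) :
    iteratedDerivWithin (j + 1) v (Ioc 0 T) t = iteratedDerivWithin j v' (Ioc 0 T) t := by
  rw [iteratedDerivWithin_succ']
  exact iteratedDerivWithin_congr
    (fun t ht => (hv t ht).derivWithin (uniqueDiffOn_Ioc (0 : ℝ) T t ht)) ht

/-- The function `v` is `C^k` on `(0,T]` and `‖v^{(j)}(t)‖ ≤ A t^(β-j)` for `0 ≤ j ≤ k`. -/
structure DerivBound (T : ℝ) (k : ℕ) (β : ℝ) (v : ℝ → Y) (A : ℝ) : Prop where
  contDiffOn : ContDiffOn ℝ k v (Ioc 0 T)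
  norm_iteratedDerivWithin_le : ∀ j ≤ k, ∀ t ∈ Ioc 0 T,
    ‖iteratedDerivWithin j v (Ioc 0 T) t‖ ≤ A * t ^ (β - j)

namespace DerivBound

lemma bound (h : DerivBound T k β v A) {t : ℝ} (ht : t ∈ Ioc 0 T) : ‖v t‖ ≤ A * t ^ β := by
  simpa using h.norm_iteratedDerivWithin_le 0 k.zero_le t ht

lemma nonneg (hT : 0 < T) (h : DerivBound T k β v A) : 0 ≤ A :=
  nonneg_of_mul_nonneg_left ((norm_nonneg _).trans (h.bound ⟨hT, le_rfl⟩))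
    (Real.rpow_pos_of_pos hT β)

lemma mono {A' : ℝ} (h : DerivBound T k β v A) (hA : A ≤ A') : DerivBound T k β v A' where
  contDiffOn := h.contDiffOn
  norm_iteratedDerivWithin_le j hj t ht := (h.norm_iteratedDerivWithin_le j hj t ht).trans
    (mul_le_mul_of_nonneg_right hA (Real.rpow_nonneg ht.1.le _))

lemma of_le {j : ℕ} (hj : j ≤ k) (h : DerivBound T k β v A) : DerivBound T j β v A where
  contDiffOn := h.contDiffOn.of_le (by exact_mod_cast hj)
  norm_iteratedDerivWithin_le i hi := h.norm_iteratedDerivWithin_le i (hi.trans hj)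

lemma weaken {β' : ℝ} (hA : 0 ≤ A) (hβ : β' ≤ β) (h : DerivBound T k β v A) :
    DerivBound T k β' v (A * T ^ (β - β')) where
  contDiffOn := h.contDiffOn
  norm_iteratedDerivWithin_le j hj t ht := calc
    _ ≤ A * t ^ (β - j) := h.norm_iteratedDerivWithin_le j hj t ht
    _ = A * t ^ (β - β') * t ^ (β' - j) := by
      rw [mul_assoc, ← Real.rpow_add ht.1, sub_add_sub_cancel]
    _ ≤ A * T ^ (β - β') * t ^ (β' - j) := by
      have := Real.rpow_le_rpow ht.1.le ht.2 (sub_nonneg.2 hβ)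
      have := Real.rpow_nonneg ht.1.le (β' - j)
      gcongr

lemma congr {w : ℝ → Y} (h : DerivBound T k β v A) (hvw : EqOn w v (Ioc 0 T)) :
    DerivBound T k β w A where
  contDiffOn := h.contDiffOn.congr hvw
  norm_iteratedDerivWithin_le j hj t ht := by
    rw [iteratedDerivWithin_congr hvw ht]
    exact h.norm_iteratedDerivWithin_le j hj t ht

lemma of_hasDerivWithinAt (h₀ : ∀ t ∈ Ioc 0 T, ‖v t‖ ≤ A * t ^ β)
    (hv : ∀ t ∈ Ioc 0 T, HasDerivWithinAt v (v' t) (Ioc 0 T) t)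
    (hv' : DerivBound T k (β - 1) v' A) : DerivBound T (k + 1) β v A where
  contDiffOn := contDiffOn_succ_of_hasDerivWithinAt hv hv'.contDiffOn
  norm_iteratedDerivWithin_le j hj t ht := by
    cases j with
    | zero => simpa using h₀ t ht
    | succ j =>
      rw [iteratedDerivWithin_succ_of_hasDerivWithinAt hv j ht]
      have h := hv'.norm_iteratedDerivWithin_le j (by lia) t ht
      push_cast
      rwa [sub_sub, add_comm] at h

lemma of_continuousOn (hv : ContinuousOn v (Ioc 0 T)) (h₀ : ∀ t ∈ Ioc 0 T, ‖v t‖ ≤ A * t ^ β) :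
    DerivBound T 0 β v A where
  contDiffOn := contDiffOn_zero.2 hv
  norm_iteratedDerivWithin_le j hj t ht := by
    obtain rfl : j = 0 := by lia
    simpa using h₀ t ht

lemma add {w : ℝ → Y} {B : ℝ} (hv : DerivBound T k β v A) (hw : DerivBound T k β w B) :
    DerivBound T k β (fun t => v t + w t) (A + B) where
  contDiffOn := hv.contDiffOn.add hw.contDiffOn
  norm_iteratedDerivWithin_le j hj t ht := by
    have hj' : (j : WithTop ℕ∞) ≤ k := by exact_mod_cast hj
    rw [iteratedDerivWithin_fun_add ht (uniqueDiffOn_Ioc 0 T)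
      ((hv.contDiffOn t ht).of_le hj') ((hw.contDiffOn t ht).of_le hj'), add_mul]
    exact norm_add_le_of_le (hv.norm_iteratedDerivWithin_le j hj t ht)
      (hw.norm_iteratedDerivWithin_le j hj t ht)

lemma clm (L : Y →L[ℝ] Z) (hv : DerivBound T k β v A) :
    DerivBound T k β (fun t => L (v t)) (‖L‖ * A) where
  contDiffOn := L.contDiff.comp_contDiffOn hv.contDiffOn
  norm_iteratedDerivWithin_le j hj t ht := by
    have hj' : (j : WithTop ℕ∞) ≤ k := by exact_mod_cast hj
    have hbound := hv.norm_iteratedDerivWithin_le j hj t ht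
    rw [← norm_iteratedFDerivWithin_eq_norm_iteratedDerivWithin] at hbound ⊢
    change ‖iteratedFDerivWithin ℝ j (L ∘ v) (Ioc 0 T) t‖ ≤ _
    rw [L.iteratedFDerivWithin_comp_left (hv.contDiffOn t ht) (uniqueDiffOn_Ioc 0 T) ht hj',
      mul_assoc]
    exact (L.norm_compContinuousMultilinearMap_le _).trans (by gcongr)

lemma neg (hv : DerivBound T k β v A) : DerivBound T k β (fun t => -v t) A where
  contDiffOn := hv.contDiffOn.neg
  norm_iteratedDerivWithin_le j hj t ht := by
    rw [iteratedDerivWithin_fun_neg, norm_neg]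
    exact hv.norm_iteratedDerivWithin_le j hj t ht

lemma sub {w : ℝ → Y} {B : ℝ} (hv : DerivBound T k β v A) (hw : DerivBound T k β w B) :
    DerivBound T k β (fun t => v t - w t) (A + B) := by
  simpa only [sub_eq_add_neg] using hv.add hw.neg

lemma const_smul (c : ℝ) (hv : DerivBound T k β v A) :
    DerivBound T k β (fun t => c • v t) (|c| * A) where
  contDiffOn := hv.contDiffOn.const_smul c
  norm_iteratedDerivWithin_le j hj t ht := by
    rw [iteratedDerivWithin_fun_const_smul_field, norm_smul, Real.norm_eq_abs, mul_assoc]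
    exact mul_le_mul_of_nonneg_left (hv.norm_iteratedDerivWithin_le j hj t ht) (abs_nonneg c)

lemma bilinear (L : Y →L[ℝ] Z →L[ℝ] W) (hL : ‖L‖ ≤ 1) {w : ℝ → Z} {γ B : ℝ}
    (hv : DerivBound T k β v A) (hw : DerivBound T k γ w B) :
    DerivBound T k (β + γ) (fun t => L (v t) (w t)) (2 ^ k * A * B) where
  contDiffOn := L.isBoundedBilinearMap.contDiff.comp_contDiffOn (hv.contDiffOn.prodMk hw.contDiffOn)
  norm_iteratedDerivWithin_le j hj t ht := by
    have hT := ht.1.trans_le ht.2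
    have hA := hv.nonneg hT
    have hB := hw.nonneg hT
    have hterm : ∀ i ∈ Finset.range (j + 1),
        j.choose i * ‖iteratedFDerivWithin ℝ i v (Ioc 0 T) t‖
          * ‖iteratedFDerivWithin ℝ (j - i) w (Ioc 0 T) t‖
        ≤ j.choose i * (A * B * t ^ (β + γ - j)) := fun i hi => by
      have hij : i ≤ j := Finset.mem_range_succ_iff.1 hi
      have hpow : t ^ (β + γ - j) = t ^ (β - i) * t ^ (γ - (j - i : ℕ)) := by
        rw [← Real.rpow_add ht.1, Nat.cast_sub hij]; ring_nf
      rw [norm_iteratedFDerivWithin_eq_norm_iteratedDerivWithin,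
        norm_iteratedFDerivWithin_eq_norm_iteratedDerivWithin, mul_assoc, hpow, mul_mul_mul_comm]
      have := Real.rpow_nonneg ht.1.le (β - i)
      gcongr
      · exact hv.norm_iteratedDerivWithin_le i (hij.trans hj) t ht
      · exact hw.norm_iteratedDerivWithin_le (j - i) (j.sub_le i |>.trans hj) t ht
    rw [← norm_iteratedFDerivWithin_eq_norm_iteratedDerivWithin]
    calc _ ≤ ∑ i ∈ Finset.range (j + 1), j.choose i * (A * B * t ^ (β + γ - j)) :=
          (L.norm_iteratedFDerivWithin_le_of_bilinear_of_le_one hv.contDiffOn hw.contDiffOn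
            (uniqueDiffOn_Ioc 0 T) ht (by exact_mod_cast hj) hL).trans (Finset.sum_le_sum hterm)
      _ = 2 ^ j * (A * B * t ^ (β + γ - j)) := by
          rw [← Finset.sum_mul, ← Nat.cast_sum, Nat.sum_range_choose, Nat.cast_pow, Nat.cast_ofNat]
      _ ≤ 2 ^ k * (A * B * t ^ (β + γ - j)) := by
          have := Real.rpow_nonneg ht.1.le (β + γ - j)
          gcongr
          exact one_le_two
      _ = _ := by ring

lemma clm_apply {L : ℝ → Y →L[ℝ] Z} {γ B : ℝ} (hL : DerivBound T k γ L B)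
    (hv : DerivBound T k β v A) :
    DerivBound T k (γ + β) (fun t => L t (v t)) (2 ^ k * B * A) :=
  hL.bilinear (ContinuousLinearMap.id ℝ (Y →L[ℝ] Z)) ContinuousLinearMap.norm_id_le hv

lemma rpow (k : ℕ) (γ : ℝ) : ∃ C, 0 ≤ C ∧ DerivBound T k γ (fun t : ℝ => t ^ γ) C := by
  induction k generalizing γ with
  | zero =>
    refine ⟨1, zero_le_one, of_continuousOn (fun t ht => ?_) fun t ht => ?_⟩
    · exact (Real.continuousAt_rpow_const _ _ (Or.inl ht.1.ne')).continuousWithinAt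
    · rw [Real.norm_of_nonneg (Real.rpow_nonneg ht.1.le _), one_mul]
  | succ k ih =>
    obtain ⟨C, _, h⟩ := ih (γ - 1)
    refine ⟨max 1 (|γ| * C), by positivity, of_hasDerivWithinAt (fun t ht => ?_) (fun t ht => ?_)
      ((h.const_smul γ).mono (le_max_right _ _))⟩
    · have := Real.rpow_nonneg ht.1.le γ
      rw [Real.norm_of_nonneg this]
      exact le_mul_of_one_le_left this (le_max_left _ _)
    · exact (Real.hasDerivAt_rpow_const (Or.inl ht.1.ne')).hasDerivWithinAt

lemma exists_rpow_smul (k : ℕ) (γ : ℝ) : ∃ C, 0 ≤ C ∧ ∀ (v : ℝ → Y) (β A : ℝ),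
    DerivBound T k β v A → DerivBound T k (γ + β) (fun t => t ^ γ • v t) (C * A) := by
  obtain ⟨C, hC, h⟩ := rpow (T := T) k γ
  exact ⟨_, by positivity, fun v β A hv => h.bilinear (ContinuousLinearMap.lsmul ℝ ℝ)
    ContinuousLinearMap.opNorm_lsmul_le hv⟩

lemma exists_smul_id (k : ℕ) : ∃ C, 0 ≤ C ∧ ∀ (v : ℝ → Y) (β A : ℝ),
    DerivBound T k (β - 1) v A → DerivBound T k β (fun t => t • v t) (C * A) := by
  obtain ⟨C, hC, h⟩ := exists_rpow_smul (Y := Y) (T := T) k 1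
  exact ⟨C, hC, fun v β A hv => by simpa using h v _ A hv⟩

lemma exists_inv_smul (k : ℕ) : ∃ C, 0 ≤ C ∧ ∀ (v : ℝ → Y) (β A : ℝ),
    DerivBound T k β v A → DerivBound T k (β - 1) (fun t => t⁻¹ • v t) (C * A) := by
  obtain ⟨C, hC, h⟩ := exists_rpow_smul (Y := Y) (T := T) k (-1)
  refine ⟨C, hC, fun v β A hv => ?_⟩
  simpa only [neg_add_eq_sub, Real.rpow_neg_one] using h v β A hv

lemma of_contDiffOn (hT : 0 < T) (hv : ContDiffOn ℝ k v (Icc 0 T)) :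
    ∃ A, 0 ≤ A ∧ DerivBound T k 0 v A := by
  induction k generalizing v with
  | zero =>
    obtain ⟨A, hA, h⟩ := exists_norm_le_of_continuousOn hv.continuousOn
    exact ⟨A, hA, of_continuousOn (hv.continuousOn.mono Ioc_subset_Icc_self) fun t ht => by
      simpa using h t ⟨ht.1.le, ht.2⟩⟩
  | succ k ih =>
    obtain ⟨A, hA, h⟩ := exists_norm_le_of_continuousOn hv.continuousOn
    push_cast at hv
    obtain ⟨hd, -, hc⟩ := (contDiffOn_succ_iff_derivWithin (uniqueDiffOn_Icc hT)).1 hv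
    obtain ⟨B, hB, h'⟩ := ih hc
    have hderiv := h'.weaken (β' := 0 - 1) hB (by norm_num)
    refine ⟨max A (B * T ^ (0 - (0 - 1) : ℝ)), by positivity,
      of_hasDerivWithinAt (fun t ht => ?_) (fun t ht => ?_) (hderiv.mono (le_max_right _ _))⟩
    · rw [Real.rpow_zero, mul_one]
      exact (h t ⟨ht.1.le, ht.2⟩).trans (le_max_left _ _)
    · exact (hd t ⟨ht.1.le, ht.2⟩).hasDerivWithinAt.mono Ioc_subset_Icc_self

end DerivBound

/-- The function `v` is continuous and bounded by `A` on `[0,T]`, it is `C^k` on `(0,T]`, and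
`‖v^{(j)}(t)‖ ≤ A t^(α-j)` for `1 ≤ j ≤ k`: a bound for `v` in `C^k_α`, with the maximum instead of
the sum of the seminorms. -/
structure WeightedBound (T α : ℝ) (k : ℕ) (v : ℝ → Y) (A : ℝ) : Prop where
  continuousOn : ContinuousOn v (Icc 0 T)
  bound : ∀ t ∈ Icc 0 T, ‖v t‖ ≤ A
  contDiffOn : ContDiffOn ℝ k v (Ioc 0 T)
  norm_iteratedDerivWithin_le : ∀ j ∈ Finset.Icc 1 k, ∀ t ∈ Ioc 0 T,
    ‖iteratedDerivWithin j v (Ioc 0 T) t‖ ≤ A * t ^ (α - j)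

namespace WeightedBound

lemma nonneg (hT : 0 ≤ T) (h : WeightedBound T α k v A) : 0 ≤ A :=
  (norm_nonneg _).trans (h.bound 0 ⟨le_rfl, hT⟩)

lemma zero (hc : ContinuousOn v (Icc 0 T)) (hb : ∀ t ∈ Icc 0 T, ‖v t‖ ≤ A) :
    WeightedBound T α 0 v A where
  continuousOn := hc
  bound := hb
  contDiffOn := contDiffOn_zero.2 (hc.mono Ioc_subset_Icc_self)
  norm_iteratedDerivWithin_le j hj := by simp at hj

lemma mono {A' : ℝ} (h : WeightedBound T α k v A) (hA : A ≤ A') : WeightedBound T α k v A' where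
  continuousOn := h.continuousOn
  bound t ht := (h.bound t ht).trans hA
  contDiffOn := h.contDiffOn
  norm_iteratedDerivWithin_le j hj t ht := (h.norm_iteratedDerivWithin_le j hj t ht).trans
    (mul_le_mul_of_nonneg_right hA (Real.rpow_nonneg ht.1.le _))

lemma of_le {i : ℕ} (hi : i ≤ k) (h : WeightedBound T α k v A) : WeightedBound T α i v A where
  continuousOn := h.continuousOn
  bound := h.bound
  contDiffOn := h.contDiffOn.of_le (by exact_mod_cast hi)
  norm_iteratedDerivWithin_le j hj :=
    h.norm_iteratedDerivWithin_le j (Finset.Icc_subset_Icc_right hi hj)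

lemma of_hasDerivWithinAt (hc : ContinuousOn v (Icc 0 T)) (hb : ∀ t ∈ Icc 0 T, ‖v t‖ ≤ A)
    (hv : ∀ t ∈ Ioc 0 T, HasDerivWithinAt v (v' t) (Ioc 0 T) t)
    (hv' : DerivBound T k (α - 1) v' A) : WeightedBound T α (k + 1) v A where
  continuousOn := hc
  bound := hb
  contDiffOn := contDiffOn_succ_of_hasDerivWithinAt hv hv'.contDiffOn
  norm_iteratedDerivWithin_le j hj t ht := by
    obtain ⟨i, rfl⟩ := Nat.exists_eq_add_of_le' (Finset.mem_Icc.1 hj).1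
    rw [iteratedDerivWithin_succ_of_hasDerivWithinAt hv i ht]
    have h := hv'.norm_iteratedDerivWithin_le i (by simpa using hj) t ht
    push_cast
    rwa [sub_sub, add_comm] at h

lemma hasDerivWithinAt (h : WeightedBound T α (k + 1) v A) {t : ℝ} (ht : t ∈ Ioc 0 T) :
    HasDerivWithinAt v (derivWithin v (Ioc 0 T) t) (Ioc 0 T) t :=
  (h.contDiffOn.differentiableOn (by simp) t ht).hasDerivWithinAt

lemma derivBound_derivWithin (h : WeightedBound T α (k + 1) v A) :
    DerivBound T k (α - 1) (derivWithin v (Ioc 0 T)) A where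
  contDiffOn := h.contDiffOn.derivWithin (uniqueDiffOn_Ioc 0 T) (by simp)
  norm_iteratedDerivWithin_le j hj t ht := by
    have h := h.norm_iteratedDerivWithin_le (j + 1) (by simpa using hj) t ht
    rw [iteratedDerivWithin_succ'] at h
    push_cast at h
    rwa [sub_sub, add_comm (1 : ℝ)]

lemma derivBound (hT : 0 < T) (hα : 0 ≤ α) (h : WeightedBound T α k v A) :
    DerivBound T k 0 v ((1 + T ^ α) * A) where
  contDiffOn := h.contDiffOn
  norm_iteratedDerivWithin_le j hj t ht := by
    have hA := h.nonneg hT.le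
    have hTα := Real.rpow_nonneg hT.le α
    have htj := Real.rpow_nonneg ht.1.le (0 - j : ℝ)
    rcases j.eq_zero_or_pos with rfl | hj0
    · simpa using (h.bound t ⟨ht.1.le, ht.2⟩).trans (le_mul_of_one_le_left hA (by linarith))
    · calc _ ≤ A * t ^ (α - j) :=
            h.norm_iteratedDerivWithin_le j (Finset.mem_Icc.2 ⟨hj0, hj⟩) t ht
        _ = t ^ α * A * t ^ (0 - j : ℝ) := by
            rw [sub_eq_add_neg, Real.rpow_add ht.1, zero_sub]; ring
        _ ≤ (1 + T ^ α) * A * t ^ (0 - j : ℝ) := by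
            have := Real.rpow_le_rpow ht.1.le ht.2 hα
            gcongr
            linarith

lemma of_derivBound (hT : 0 < T) (hα : 0 < α) (h : DerivBound T k α v A) (h0 : v 0 = 0) :
    WeightedBound T α k v ((1 + T ^ α) * A) := by
  have hA := h.nonneg hT
  have hTα := Real.rpow_nonneg hT.le α
  have hA' : A ≤ (1 + T ^ α) * A := le_mul_of_one_le_left hA (by linarith)
  have hb : ∀ t ∈ Icc 0 T, ‖v t‖ ≤ A * t ^ α := fun t ht => by
    rcases ht.1.eq_or_lt with rfl | h1
    · simp [h0, Real.zero_rpow hα.ne']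
    · exact h.bound ⟨h1, ht.2⟩
  refine ⟨fun t ht => ?_, fun t ht => (hb t ht).trans ?_, h.contDiffOn, fun j hj =>
    (h.mono hA').norm_iteratedDerivWithin_le j (Finset.mem_Icc.1 hj).2⟩
  · rcases ht.1.eq_or_lt with rfl | h1
    · have : Tendsto (fun s : ℝ => A * s ^ α) (𝓝[Icc 0 T] 0) (𝓝 (A * 0 ^ α)) :=
        ((Real.continuous_rpow_const hα.le).continuousWithinAt).const_mul A
      rw [Real.zero_rpow hα.ne', mul_zero] at this
      rw [ContinuousWithinAt, h0]
      refine squeeze_zero_norm' ?_ this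
      filter_upwards [self_mem_nhdsWithin] with s hs using hb s hs
    · refine (h.contDiffOn.continuousOn t ⟨h1, ht.2⟩).mono_of_mem_nhdsWithin ?_
      filter_upwards [self_mem_nhdsWithin, mem_nhdsWithin_of_mem_nhds (Ioi_mem_nhds h1)]
        with s hs hs' using ⟨hs', hs.2⟩
  · have : t ^ α ≤ T ^ α := Real.rpow_le_rpow ht.1 ht.2 hα.le
    nlinarith

lemma exists_frac (hT : 0 < T) (hα : 0 < α) (k : ℕ) : ∃ C, 0 ≤ C ∧ ∀ (u : ℝ → Y) A,
    WeightedBound T α k u A → DerivBound T k α (frac α u) (C * A) := by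
  have hI := integral_omega_one_sub_nonneg hα
  set I := ∫ σ in (0 : ℝ)..1, omega α (1 - σ)
  have hbd : ∀ k (u : ℝ → Y) A, WeightedBound T α k u A →
      ∀ t ∈ Ioc 0 T, ‖frac α u t‖ ≤ I * A * t ^ α := fun k u A hu t ht =>
    norm_frac_le hα ⟨ht.1.le, ht.2⟩ hu.bound
  induction k with
  | zero =>
    exact ⟨I, hI, fun u A hu => .of_continuousOn
      ((continuousOn_frac hα hu.continuousOn).mono Ioc_subset_Icc_self) (hbd 0 u A hu)⟩
  | succ k ih =>
    obtain ⟨C, _, hfrac⟩ := ih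
    obtain ⟨D, _, hid⟩ := DerivBound.exists_smul_id (Y := Y) (T := T) k
    obtain ⟨D', _, hinv⟩ := DerivBound.exists_inv_smul (Y := Y) (T := T) k
    have := Real.rpow_nonneg hT.le α
    refine ⟨max I (D' * (|α| * C + C * ((1 + T ^ α) * D))), by positivity, fun u A hu => ?_⟩
    have hA := hu.nonneg hT.le
    have hw := of_derivBound hT hα (hid _ α A hu.derivBound_derivWithin) (by simp)
    have hu' : ∀ t ∈ Ioc 0 T, HasDerivWithinAt u
        (t⁻¹ • (t • derivWithin u (Ioc 0 T) t)) (Ioc 0 T) t := fun t ht => by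
      rw [inv_smul_smul₀ ht.1.ne']; exact hu.hasDerivWithinAt ht
    refine .of_hasDerivWithinAt (fun t ht => (hbd _ u A hu t ht).trans ?_)
      (fun t ht => hasDerivWithinAt_frac hα hu.continuousOn hw.continuousOn hu' ht) ?_
    · have := Real.rpow_nonneg ht.1.le α
      gcongr
      exact le_max_left _ _
    · refine (hinv _ α _ (((hfrac u A (hu.of_le k.le_succ)).const_smul α).add
        (hfrac _ _ hw))).mono ?_
      calc _ = D' * (|α| * C + C * ((1 + T ^ α) * D)) * A := by ring
        _ ≤ _ := by gcongr; exact le_max_right _ _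

end WeightedBound

end derivBound

/-! ### Regularity of solutions of weakly singular Volterra equations -/

section regularity

variable {Y : Type*} [NormedAddCommGroup Y] [NormedSpace ℝ Y] {T α A : ℝ} {k : ℕ}
  {B B' D : ℝ → Y →L[ℝ] Y} {u v w h h' : ℝ → Y}

lemma isVolterra_clm_frac (hα : 0 < α) (hα1 : α ≤ 1) (hB : ContinuousOn B (Icc 0 T)) :
    IsVolterra T (α / 2) fun u t => B t (frac α u t) :=
  (isVolterra_frac (half_pos hα) (by linarith) (by linarith)).clm_apply hB

lemma hasDerivWithinAt_clm_frac {t : ℝ} (hα : 0 < α)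
    (hB : HasDerivWithinAt B (B' t) (Ioc 0 T) t) (hu : ContinuousOn u (Icc 0 T))
    (hw : ContinuousOn w (Icc 0 T))
    (huw : ∀ t ∈ Ioc 0 T, HasDerivWithinAt u (t⁻¹ • w t) (Ioc 0 T) t) (ht : t ∈ Ioc 0 T) :
    HasDerivWithinAt (fun t => B t (frac α u t))
      (t⁻¹ • ((t • B' t + α • B t) (frac α u t) + B t (frac α w t))) (Ioc 0 T) t := by
  refine (hB.clm_apply (hasDerivWithinAt_frac hα hu hw huw ht)).congr_deriv ?_
  simp only [add_apply, smul_apply, map_smul, map_add, smul_add, inv_smul_smul₀ ht.1.ne',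
    add_assoc]

/-- A candidate `v` whose derivative is the one obtained by formally differentiating
`u + B I^α u = h` agrees with `u`: the residual `v + B I^α v - h` is the primitive of
`t⁻¹ (t B' + α B) I^α (v - u)`, so that `v - u` solves a homogeneous Volterra equation. -/
lemma eqOn_of_hasDerivWithinAt_of_frac_eq [CompleteSpace Y] (hα : 0 < α) (hα1 : α ≤ 1)
    (hB : ContinuousOn B (Icc 0 T)) (hB' : ContinuousOn B' (Icc 0 T))
    (hBB' : ∀ t ∈ Ioc 0 T, HasDerivWithinAt B (B' t) (Ioc 0 T) t)
    (hu : ContinuousOn u (Icc 0 T)) (hh : ContinuousOn h (Icc 0 T))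
    (hhw : ∀ t ∈ Ioc 0 T, HasDerivWithinAt h
      (t⁻¹ • (w t + B t (frac α w t) + (t • B' t + α • B t) (frac α u t))) (Ioc 0 T) t)
    (heq : ∀ t ∈ Icc 0 T, u t + B t (frac α u t) = h t)
    (hv : ContinuousOn v (Icc 0 T)) (hw : ContinuousOn w (Icc 0 T))
    (hvw : ∀ t ∈ Ioc 0 T, HasDerivWithinAt v (t⁻¹ • w t) (Ioc 0 T) t) (h0 : v 0 = u 0) :
    EqOn u v (Icc 0 T) := by
  set E : ℝ → Y →L[ℝ] Y := fun t => t • B' t + α • B t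
  have hV := isVolterra_clm_frac hα hα1 hB
  have hVE : IsVolterra T (α / 2) fun u t => E t (frac α u t) :=
    isVolterra_clm_frac hα hα1 ((continuousOn_id.smul hB').add (hB.const_smul α))
  have hvu : ContinuousOn (v - u) (Icc 0 T) := hv.sub hu
  have hresidual : ∀ t ∈ Ioc 0 T, HasDerivWithinAt (fun t => v t + B t (frac α v t) - h t)
      (t⁻¹ • E t (frac α (v - u) t)) (Ioc 0 T) t := fun t ht => by
    refine (((hvw t ht).add (hasDerivWithinAt_clm_frac hα (hBB' t ht) hv hw hvw ht)).sub
      (hhw t ht)).congr_deriv ?_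
    rw [hVE.map_sub v u hv hu t ⟨ht.1.le, ht.2⟩, ← smul_add, ← smul_sub]
    congr 1
    simp only [E]
    abel
  have hprimitive : ∀ t ∈ Icc 0 T, ∫ s in (0 : ℝ)..t, s⁻¹ • E s (frac α (v - u) s)
      = v t + B t (frac α v t) - h t := fun t ht => by
    obtain ⟨C, hC⟩ := hVE.exists_norm_inv_smul_le_rpow hvu
    have hh0 := heq 0 ⟨le_rfl, ht.1.trans ht.2⟩
    rw [frac_zero hα.ne', map_zero, add_zero] at hh0
    rw [integral_eq_sub_of_hasDerivWithinAt (by linarith) ((hv.add (hV.continuousOn v hv)).sub hh)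
      (hVE.continuousOn_inv_smul hvu) hC hresidual ht]
    simp only [Pi.sub_apply, Pi.add_apply, frac_zero hα.ne', map_zero, add_zero, h0, hh0, sub_self,
      sub_zero]
  have hW := hV.sub (hVE.integral_inv_smul (half_pos hα))
  refine hW.eqOn_of_add_eq (half_pos hα) hu hv fun t ht => ?_
  have hWvu := hW.map_sub v u hv hu t ht
  rw [hprimitive t ht, hV.map_sub v u hv hu t ht, ← heq t ht] at hWvu
  rw [← sub_eq_zero, add_sub_add_comm, ← neg_sub _ (_ - _), ← hWvu]
  abel

lemma exists_hasDerivWithinAt_of_frac_eq [CompleteSpace Y] (hT : 0 < T) (hα : 0 < α) (hα1 : α ≤ 1)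
    (hB : ContinuousOn B (Icc 0 T)) (hB' : ContinuousOn B' (Icc 0 T))
    (hBB' : ∀ t ∈ Ioc 0 T, HasDerivWithinAt B (B' t) (Ioc 0 T) t)
    (hu : ContinuousOn u (Icc 0 T)) (hh : ContinuousOn h (Icc 0 T))
    (hhh' : ∀ t ∈ Ioc 0 T, HasDerivWithinAt h (h' t) (Ioc 0 T) t)
    (hh' : DerivBound T 0 (α - 1) h' A)
    (heq : ∀ t ∈ Icc 0 T, u t + B t (frac α u t) = h t) :
    ∃ w : ℝ → Y, ContinuousOn w (Icc 0 T) ∧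
      (∀ t ∈ Ioc 0 T, HasDerivWithinAt u (t⁻¹ • w t) (Ioc 0 T) t) ∧
      ∀ t ∈ Icc 0 T,
        w t + B t (frac α w t) = t • h' t - (t • B' t + α • B t) (frac α u t) := by
  have hV := isVolterra_clm_frac hα hα1 hB
  have hVE := isVolterra_clm_frac (B := fun t => t • B' t + α • B t) hα hα1
    ((continuousOn_id.smul hB').add (hB.const_smul α))
  obtain ⟨D, -, hid⟩ := DerivBound.exists_smul_id (Y := Y) (T := T) 0
  have hth' := (WeightedBound.of_derivBound hT hα (hid h' α A hh') (by simp)).continuousOn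
  obtain ⟨w, hw, hweq⟩ := hV.exists_solution (half_pos hα) hT.le (hth'.sub (hVE.continuousOn u hu))
  have hh'w : ∀ t ∈ Ioc 0 T, h' t =
      t⁻¹ • (w t + B t (frac α w t) + (t • B' t + α • B t) (frac α u t)) := fun t ht => by
    rw [hweq t ⟨ht.1.le, ht.2⟩, Pi.sub_apply, sub_add_cancel, inv_smul_smul₀ ht.1.ne']
  obtain ⟨C, hC⟩ : ∃ C, ∀ t ∈ Ioc 0 T, ‖t⁻¹ • w t‖ ≤ C * t ^ (α / 2 - 1) := by
    obtain ⟨Cw, hCw⟩ := hV.exists_norm_inv_smul_le_rpow hw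
    obtain ⟨Cu, hCu⟩ := hVE.exists_norm_inv_smul_le_rpow hu
    have hbound := hh'.weaken (β' := α / 2 - 1) (hh'.nonneg hT) (by linarith)
    refine ⟨A * T ^ (α - 1 - (α / 2 - 1)) + Cw + Cu, fun t ht => ?_⟩
    have hw' : t⁻¹ • w t = h' t - t⁻¹ • B t (frac α w t)
        - t⁻¹ • (t • B' t + α • B t) (frac α u t) := by
      simp only [hh'w t ht, smul_add (t⁻¹)]
      abel
    rw [hw', add_mul, add_mul]
    exact norm_sub_le_of_le (norm_sub_le_of_le (hbound.bound ht) (hCw t ht)) (hCu t ht)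
  have hα2 : -1 < α / 2 - 1 := by linarith
  have hwc : ContinuousOn (fun t => t⁻¹ • w t) (Ioc 0 T) :=
    (continuousOn_id.inv₀ fun s hs => hs.1.ne').smul (hw.mono Ioc_subset_Icc_self)
  have hvw : ∀ t ∈ Ioc 0 T, HasDerivWithinAt (fun t => u 0 + ∫ s in (0 : ℝ)..t, s⁻¹ • w s)
      (t⁻¹ • w t) (Ioc 0 T) t := fun t ht =>
    (hasDerivWithinAt_primitive hα2 hwc hC ht).const_add _
  have huv := eqOn_of_hasDerivWithinAt_of_frac_eq hα hα1 hB hB' hBB' hu hh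
    (fun t ht => hh'w t ht ▸ hhh' t ht) heq
    (continuousOn_const.add (continuousOn_primitive_of_norm_le_rpow hα2 hwc hC)) hw hvw (by simp)
  exact ⟨w, hw, fun t ht => (hvw t ht).congr (fun s hs => huv ⟨hs.1.le, hs.2⟩)
    (huv ⟨ht.1.le, ht.2⟩), hweq⟩

lemma exists_derivBound_clm_frac (hT : 0 < T) (hα : 0 < α) (hB : ContDiffOn ℝ k B (Icc 0 T)) :
    ∃ C, 0 ≤ C ∧ ∀ (u : ℝ → Y) A, WeightedBound T α k u A →
      DerivBound T k α (fun t => B t (frac α u t)) (C * A) := by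
  obtain ⟨b, hb, hBb⟩ := DerivBound.of_contDiffOn hT hB
  obtain ⟨C, hC, hfrac⟩ := WeightedBound.exists_frac (Y := Y) hT hα k
  refine ⟨2 ^ k * b * C, by positivity, fun u A hu => ?_⟩
  simpa only [zero_add, mul_assoc] using hBb.clm_apply (hfrac u A hu)

lemma exists_derivBound_deriv_of_frac_eq [CompleteSpace Y] (hT : 0 < T) (hα : 0 < α)
    (hα1 : α ≤ 1) (hB : ContDiffOn ℝ (k + 1) B (Icc 0 T)) {C : ℝ} (hC : 0 ≤ C)
    (hreg : ∀ (u h : ℝ → Y) A, ContinuousOn u (Icc 0 T) → WeightedBound T α k h A →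
      (∀ t ∈ Icc 0 T, u t + B t (frac α u t) = h t) → WeightedBound T α k u (C * A)) :
    ∃ C', 0 ≤ C' ∧ ∀ (u h : ℝ → Y) A, ContinuousOn u (Icc 0 T) → WeightedBound T α (k + 1) h A →
      (∀ t ∈ Icc 0 T, u t + B t (frac α u t) = h t) →
      ∃ u' : ℝ → Y, (∀ t ∈ Ioc 0 T, HasDerivWithinAt u (u' t) (Ioc 0 T) t) ∧
        DerivBound T k (α - 1) u' (C' * A) := by
  have hBk : ContDiffOn ℝ k B (Icc 0 T) := hB.of_le (by exact_mod_cast k.le_succ)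
  obtain ⟨hd, -, hB'⟩ := (contDiffOn_succ_iff_derivWithin (uniqueDiffOn_Icc hT)).1 hB
  have hBB' : ∀ t ∈ Ioc 0 T, HasDerivWithinAt B (derivWithin B (Icc 0 T) t) (Ioc 0 T) t :=
    fun t ht => (hd t ⟨ht.1.le, ht.2⟩).hasDerivWithinAt.mono Ioc_subset_Icc_self
  have hE : ContDiffOn ℝ k (fun t => t • derivWithin B (Icc 0 T) t + α • B t) (Icc 0 T) :=
    (contDiffOn_id.smul hB').add (hBk.const_smul α)
  obtain ⟨e, he, hEfrac⟩ := exists_derivBound_clm_frac hT hα hE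
  obtain ⟨b, hb, hBfrac⟩ := exists_derivBound_clm_frac hT hα hBk
  obtain ⟨D, hD, hid⟩ := DerivBound.exists_smul_id (Y := Y) (T := T) k
  obtain ⟨D', hD', hinv⟩ := DerivBound.exists_inv_smul (Y := Y) (T := T) k
  have := Real.rpow_nonneg hT.le α
  set C₁ := D + e * C
  set C₂ := C * ((1 + T ^ α) * C₁)
  refine ⟨D' * (C₁ + b * C₂), by positivity, fun u h A hu hh heq => ?_⟩
  obtain ⟨w, hw, huw, hweq⟩ := exists_hasDerivWithinAt_of_frac_eq hT hα hα1 hB.continuousOn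
    hB'.continuousOn hBB' hu hh.continuousOn (fun t ht => hh.hasDerivWithinAt ht)
    (hh.derivBound_derivWithin.of_le k.zero_le) heq
  have hrhs := ((hid _ α A hh.derivBound_derivWithin).sub (hEfrac u _
    (hreg u h A hu (hh.of_le k.le_succ) heq))).mono (A' := C₁ * A) (by simp only [C₁]; linarith)
  have hwk : WeightedBound T α k w (C₂ * A) :=
    (hreg w _ _ hw (.of_derivBound hT hα hrhs (by simp [frac_zero hα.ne'])) hweq).mono
      (by simp only [C₂]; linarith)
  have hwα : DerivBound T k α w (C₁ * A + b * (C₂ * A)) :=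
    (hrhs.sub (hBfrac w _ hwk)).congr fun t ht => eq_sub_of_add_eq (hweq t ⟨ht.1.le, ht.2⟩)
  exact ⟨_, huw, (hinv w α _ hwα).mono (by linarith)⟩

lemma exists_weightedBound_of_frac_eq [CompleteSpace Y] (hT : 0 < T) (hα : 0 < α) (hα1 : α ≤ 1)
    (k : ℕ) (hB : ContDiffOn ℝ k B (Icc 0 T)) :
    ∃ C, 0 ≤ C ∧ ∀ (u h : ℝ → Y) A, ContinuousOn u (Icc 0 T) → WeightedBound T α k h A →
      (∀ t ∈ Icc 0 T, u t + B t (frac α u t) = h t) → WeightedBound T α k u (C * A) := by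
  obtain ⟨C₀, hC₀, hstable⟩ :=
    (isVolterra_clm_frac hα hα1 hB.continuousOn).exists_norm_le_of_norm_add_le (half_pos hα)
  have hbound : ∀ k (u h : ℝ → Y) A, ContinuousOn u (Icc 0 T) → WeightedBound T α k h A →
      (∀ t ∈ Icc 0 T, u t + B t (frac α u t) = h t) → ∀ t ∈ Icc 0 T, ‖u t‖ ≤ C₀ * A :=
    fun k u h A hu hh heq => hstable u A hu fun t ht => by rw [heq t ht]; exact hh.bound t ht
  induction k with
  | zero => exact ⟨C₀, by linarith, fun u h A hu hh heq => .zero hu (hbound 0 u h A hu hh heq)⟩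
  | succ k ih =>
    obtain ⟨C, hC, hreg⟩ := ih (hB.of_le (by exact_mod_cast k.le_succ))
    obtain ⟨C', _, hderiv⟩ := exists_derivBound_deriv_of_frac_eq hT hα hα1
      (by exact_mod_cast hB) hC hreg
    refine ⟨max C₀ C', by positivity, fun u h A hu hh heq => ?_⟩
    have hA := hh.nonneg hT.le
    obtain ⟨u', huu', hu'⟩ := hderiv u h A hu hh heq
    refine .of_hasDerivWithinAt hu (fun t ht => (hbound _ u h A hu hh heq t ht).trans ?_) huu'
      (hu'.mono ?_)
    · gcongr
      exact le_max_left _ _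
    · gcongr
      exact le_max_right _ _

lemma WeightedBound.sub {A' : ℝ} (hv : WeightedBound T α k v A) (hw : WeightedBound T α k w A') :
    WeightedBound T α k (fun t => v t - w t) (A + A') where
  continuousOn := hv.continuousOn.sub hw.continuousOn
  bound t ht := norm_sub_le_of_le (hv.bound t ht) (hw.bound t ht)
  contDiffOn := hv.contDiffOn.sub hw.contDiffOn
  norm_iteratedDerivWithin_le j hj t ht := by
    have hj' : (j : WithTop ℕ∞) ≤ k := by exact_mod_cast (Finset.mem_Icc.1 hj).2
    change ‖iteratedDerivWithin j (v - w) (Ioc 0 T) t‖ ≤ _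
    rw [iteratedDerivWithin_sub ht (uniqueDiffOn_Ioc 0 T)
      ((hv.contDiffOn t ht).of_le hj') ((hw.contDiffOn t ht).of_le hj'), add_mul]
    exact norm_sub_le_of_le (hv.norm_iteratedDerivWithin_le j hj t ht)
      (hw.norm_iteratedDerivWithin_le j hj t ht)

lemma DerivBound.weightedBound_primitive [CompleteSpace Y] (hT : 0 < T) (hα : 0 < α)
    (hv : DerivBound T k (α - 1) v A) :
    WeightedBound T α (k + 1) (fun t => ∫ s in (0 : ℝ)..t, v s) ((1 + T ^ α / α) * A) := by
  have hα' : -1 < α - 1 := by linarith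
  have hA := hv.nonneg hT
  have := Real.rpow_nonneg hT.le α
  have hb : ∀ t ∈ Ioc 0 T, ‖v t‖ ≤ A * t ^ (α - 1) := fun t ht => hv.bound ht
  have hc := hv.contDiffOn.continuousOn
  refine .of_hasDerivWithinAt (continuousOn_primitive_of_norm_le_rpow hα' hc hb)
    (fun t ht => (norm_primitive_le hα' hb ht).trans ?_)
    (fun t ht => hasDerivWithinAt_primitive hα' hc hb ht)
    (hv.mono (le_mul_of_one_le_left hA (le_add_of_nonneg_right (by positivity))))
  rw [sub_add_cancel]
  have htT : t ^ α ≤ T ^ α := Real.rpow_le_rpow ht.1 ht.2 hα.le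
  calc A * (t ^ α / α) ≤ A * (T ^ α / α) := by gcongr
    _ ≤ (1 + T ^ α / α) * A := by linarith

/-- The operator `u ↦ B I^α u + ∫ (D u - B' I^α u)`, the form taken by the integral operator with
kernel `K_X` after interchanging the order of integration; there `B`, `B'`, `D` are the compressions
of `K₁`, `K₁'`, `K₂` to `X`. -/
def volterraOp (α : ℝ) (B B' D : ℝ → Y →L[ℝ] Y) (u : ℝ → Y) (t : ℝ) : Y :=
  B t (frac α u t) + ∫ s in (0 : ℝ)..t, (D s (u s) - B' s (frac α u s))

lemma isVolterra_volterraOp (hα : 0 < α) (hα1 : α ≤ 1) (hB : ContinuousOn B (Icc 0 T))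
    (hB' : ContinuousOn B' (Icc 0 T)) (hD : ContinuousOn D (Icc 0 T)) :
    IsVolterra T (α / 2) (volterraOp α B B' D) := by
  have hfrac : IsVolterra T (α / 2) (frac 1 : (ℝ → Y) → ℝ → Y) :=
    isVolterra_frac (half_pos hα) (by linarith) (by linarith)
  refine ((isVolterra_clm_frac hα hα1 hB).add ((hfrac.comp_clm_apply hD).sub
    (hfrac.comp (half_pos hα).le (isVolterra_clm_frac hα hα1 hB')))).congr fun u hu t ht => ?_
  have hint : ∀ {v : ℝ → Y}, ContinuousOn v (Icc 0 T) → IntervalIntegrable v volume 0 t :=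
    fun hv => (hv.mono (Icc_subset_Icc_right ht.2)).intervalIntegrable_of_Icc ht.1
  simp only [volterraOp, frac_one ht.1]
  rw [intervalIntegral.integral_sub (hint (hD.clm_apply hu))
    (hint (hB'.clm_apply (continuousOn_frac hα hu)))]

lemma exists_derivBound_sub_clm_frac (hT : 0 < T) (hα : 0 < α) (hα1 : α ≤ 1)
    (hB' : ContDiffOn ℝ k B' (Icc 0 T)) (hD : ContDiffOn ℝ k D (Icc 0 T)) :
    ∃ C, 0 ≤ C ∧ ∀ (u : ℝ → Y) A, WeightedBound T α k u A →
      DerivBound T k (α - 1) (fun t => D t (u t) - B' t (frac α u t)) (C * A) := by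
  obtain ⟨δ, hδ, hDδ⟩ := DerivBound.of_contDiffOn hT hD
  obtain ⟨b, hb, hBfrac⟩ := exists_derivBound_clm_frac hT hα hB'
  have := Real.rpow_nonneg hT.le α
  refine ⟨2 ^ k * δ * (1 + T ^ α) * T ^ (0 + 0 - (α - 1)) + b * T ^ (α - (α - 1)), by positivity,
    fun u A hu => ?_⟩
  have hA := hu.nonneg hT.le
  have hDu := (hDδ.clm_apply (hu.derivBound hT hα.le)).weaken (β' := α - 1) (by positivity)
    (by linarith)
  have hBu := (hBfrac u A hu).weaken (β' := α - 1) (by positivity) (by linarith)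
  exact (hDu.sub hBu).mono (by linarith)

lemma exists_weightedBound_of_volterraOp_eq [CompleteSpace Y] (hT : 0 < T) (hα : 0 < α)
    (hα1 : α ≤ 1) (k : ℕ) (hB : ContDiffOn ℝ k B (Icc 0 T))
    (hB' : ContDiffOn ℝ (k - 1 : ℕ) B' (Icc 0 T)) (hD : ContDiffOn ℝ (k - 1 : ℕ) D (Icc 0 T)) :
    ∃ C, 0 ≤ C ∧ ∀ (u f : ℝ → Y) A, ContinuousOn u (Icc 0 T) → WeightedBound T α k f A →
      (∀ t ∈ Icc 0 T, u t + volterraOp α B B' D u t = f t) → WeightedBound T α k u (C * A) := by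
  induction k with
  | zero =>
    obtain ⟨C, hC, hstable⟩ := (isVolterra_volterraOp hα hα1 hB.continuousOn hB'.continuousOn
      hD.continuousOn).exists_norm_le_of_norm_add_le (half_pos hα)
    exact ⟨C, by linarith, fun u f A hu hf heq => .zero hu
      (hstable u A hu fun t ht => by rw [heq t ht]; exact hf.bound t ht)⟩
  | succ k ih =>
    rw [Nat.add_sub_cancel] at hB' hD
    have hk : ((k - 1 : ℕ) : WithTop ℕ∞) ≤ k := by exact_mod_cast k.sub_le 1
    obtain ⟨C, hC, hreg⟩ := ih (hB.of_le (by exact_mod_cast k.le_succ)) (hB'.of_le hk) (hD.of_le hk)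
    obtain ⟨K, hK, hfrac⟩ := exists_weightedBound_of_frac_eq hT hα hα1 (k + 1) hB
    obtain ⟨G, hG, hintegrand⟩ := exists_derivBound_sub_clm_frac hT hα hα1 hB' hD
    have := Real.rpow_nonneg hT.le α
    refine ⟨K * (1 + (1 + T ^ α / α) * (G * C)), by positivity, fun u f A hu hf heq => ?_⟩
    have huk := hreg u f A hu (hf.of_le k.le_succ) heq
    have hh := hf.sub ((hintegrand u _ huk).weightedBound_primitive hT hα)
    refine (hfrac u _ _ hu hh fun t ht => ?_).mono (by linarith)
    rw [← heq t ht, volterraOp]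
    abel

end regularity

/-! ### The iterated kernel -/

section triangle

variable {Y : Type*} [NormedAddCommGroup Y] [NormedSpace ℝ Y] {a b : ℝ} {F : ℝ → ℝ → Y}

/-- The triangle of the pairs `(z, s)` with `a < s < z ≤ b`, in the order used by convolutions. -/
def triangle (a b : ℝ) : Set (ℝ × ℝ) := {p | a < p.2 ∧ p.2 < p.1 ∧ p.1 ≤ b}

lemma measurableSet_triangle (a b : ℝ) : MeasurableSet (triangle a b) :=
  (measurableSet_lt measurable_const measurable_snd).inter
    ((measurableSet_lt measurable_snd measurable_fst).inter
      (measurableSet_le measurable_fst measurable_const))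

lemma integral_fst_indicator_triangle (s : ℝ) :
    ∫ z, (triangle a b).indicator (Function.uncurry F) (z, s)
      = (Ioc a b).indicator (fun s => ∫ z in s..b, F z s) s := by
  by_cases hs : s ∈ Ioc a b
  · rw [indicator_of_mem hs, intervalIntegral.integral_of_le hs.2,
      ← integral_indicator measurableSet_Ioc]
    simp only [indicator_apply, triangle, mem_ofPred_eq, mem_Ioc, hs.1, true_and,
      Function.uncurry_apply_pair]
  · rw [indicator_of_notMem hs]
    refine integral_eq_zero_of_ae (ae_of_all _ fun z => indicator_of_notMem (fun hz => hs ?_) _)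
    exact ⟨hz.1, hz.2.1.le.trans hz.2.2⟩

lemma integral_snd_indicator_triangle (z : ℝ) :
    ∫ s, (triangle a b).indicator (Function.uncurry F) (z, s)
      = (Ioc a b).indicator (fun z => ∫ s in a..z, F z s) z := by
  by_cases hz : z ∈ Ioc a b
  · rw [indicator_of_mem hz, intervalIntegral.integral_of_le hz.1.le, integral_Ioc_eq_integral_Ioo,
      ← integral_indicator measurableSet_Ioo]
    simp only [indicator_apply, triangle, mem_ofPred_eq, mem_Ioo, hz.2, and_true,
      Function.uncurry_apply_pair]
  · rw [indicator_of_notMem hz]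
    refine integral_eq_zero_of_ae (ae_of_all _ fun s => indicator_of_notMem (fun hs => hz ?_) _)
    exact ⟨hs.1.trans hs.2.1, hs.2.2⟩

lemma intervalIntegrable_integral_of_integrableOn_triangle (hab : a ≤ b)
    (hF : IntegrableOn (Function.uncurry F) (triangle a b)) :
    IntervalIntegrable (fun s => ∫ z in s..b, F z s) volume a b := by
  rw [intervalIntegrable_iff_integrableOn_Ioc_of_le hab, ← integrable_indicator_iff
    measurableSet_Ioc]
  refine ((integrable_indicator_iff (measurableSet_triangle a b)).2 hF).integral_prod_right.congr
    (ae_of_all _ fun s => integral_fst_indicator_triangle s)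

lemma integral_integral_swap_of_integrableOn_triangle (hab : a ≤ b)
    (hF : IntegrableOn (Function.uncurry F) (triangle a b)) :
    ∫ s in a..b, ∫ z in s..b, F z s = ∫ z in a..b, ∫ s in a..z, F z s := by
  simp only [intervalIntegral.integral_of_le hab, ← integral_indicator measurableSet_Ioc,
    ← integral_fst_indicator_triangle, ← integral_snd_indicator_triangle]
  exact (integral_integral_swap
    (f := fun z s => (triangle a b).indicator (Function.uncurry F) (z, s))
    ((integrable_indicator_iff (measurableSet_triangle a b)).2 hF)).symm

end triangle

section kernel

variable {Y Z : Type*} [NormedAddCommGroup Y] [NormedSpace ℝ Y] [NormedAddCommGroup Z]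
  [NormedSpace ℝ Z] {T α s t : ℝ} {B : ℝ → Y →L[ℝ] Y} {u : ℝ → Y}

lemma intervalIntegrable_omega_smul {B : ℝ → Z} (hα : 0 < α) (hB : ContinuousOn B (Icc 0 T))
    (hs : 0 ≤ s) (hst : s ≤ t) (ht : t ≤ T) :
    IntervalIntegrable (fun z => omega α (z - s) • B z) volume s t := by
  have hω : IntervalIntegrable (fun z => omega α (z - s)) volume s t := by
    have hrpow := (intervalIntegral.intervalIntegrable_rpow' (a := 0) (b := t - s)
      (by linarith : -1 < α - 1)).div_const (Real.Gamma α)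
    simpa [omega] using hrpow.comp_sub_right s
  refine hω.smul_continuousOn (hB.mono ?_)
  rw [uIcc_of_le hst]
  exact Icc_subset_Icc hs ht

lemma intervalIntegrable_omega_sub_smul (hα : 0 < α) (hu : ContinuousOn u (Icc 0 T))
    (ht : t ∈ Icc 0 T) : IntervalIntegrable (fun s => omega α (t - s) • u s) volume 0 t := by
  refine (intervalIntegrable_omega_sub hα 0 t t).smul_continuousOn (hu.mono ?_)
  rw [uIcc_of_le ht.1]
  exact Icc_subset_Icc_right ht.2

lemma integrableOn_omega_smul_clm_triangle (hα : 0 < α) (hB : ContinuousOn B (Icc 0 t))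
    (hu : ContinuousOn u (Icc 0 t)) :
    IntegrableOn (Function.uncurry fun z s => omega α (z - s) • B z (u s)) (triangle 0 t) := by
  have hsub : Ioc 0 t ⊆ Icc 0 t := Ioc_subset_Icc_self
  obtain ⟨b, hb0, hb⟩ := exists_norm_le_of_continuousOn hB
  have hu' : Integrable ((Ioc 0 t).indicator u) :=
    (integrable_indicator_iff measurableSet_Ioc).2 ((hu.integrableOn_Icc).mono_set hsub)
  have hω : Integrable ((Ioc 0 t).indicator (omega α)) := by
    rw [integrable_indicator_iff measurableSet_Ioc]
    exact ((intervalIntegral.intervalIntegrable_rpow' (by linarith : -1 < α - 1)).div_const _).1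
  have hconv := hu'.convolution_integrand
    (ContinuousLinearMap.lsmul ℝ ℝ : ℝ →L[ℝ] Y →L[ℝ] Y).flip hω
  have hBm : AEStronglyMeasurable ((Ioc 0 t).indicator B) volume :=
    (aestronglyMeasurable_indicator_iff measurableSet_Ioc).2
      ((hB.mono hsub).aestronglyMeasurable measurableSet_Ioc)
  have hB_le : ∀ z, ‖(Ioc 0 t).indicator B z‖ ≤ b := fun z => by
    by_cases hz : z ∈ Ioc 0 t
    · rw [indicator_of_mem hz]
      exact hb z (hsub hz)
    · rwa [indicator_of_notMem hz, norm_zero]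
  have hmain : Integrable (fun p : ℝ × ℝ => (Ioc 0 t).indicator B p.1
      ((Ioc 0 t).indicator (omega α) (p.1 - p.2) • (Ioc 0 t).indicator u p.2)) :=
    (hconv.norm.const_mul b).mono'
      ((ContinuousLinearMap.id ℝ (Y →L[ℝ] Y)).aestronglyMeasurable_comp₂
        (hBm.comp_fst (ν := (volume : Measure ℝ))) hconv.aestronglyMeasurable)
      (ae_of_all _ fun p => ContinuousLinearMap.le_of_opNorm_le _ (hB_le p.1) _)
  refine hmain.integrableOn.congr_fun (fun p hp => ?_) (measurableSet_triangle 0 t)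
  obtain ⟨h0, hlt, hle⟩ := hp
  simp only [Function.uncurry, indicator_of_mem (show p.1 ∈ Ioc 0 t from ⟨h0.trans hlt, hle⟩),
    indicator_of_mem (show p.2 ∈ Ioc 0 t from ⟨h0, hlt.le.trans hle⟩),
    indicator_of_mem (show p.1 - p.2 ∈ Ioc 0 t from ⟨sub_pos.2 hlt, by linarith⟩), map_smul]

lemma integral_kernel_apply [CompleteSpace Y] (hα : 0 < α) (hB : ContinuousOn B (Icc 0 t))
    (hs : s ∈ Icc 0 t) (y : Y) :
    (∫ z in s..t, omega α (z - s) • B z) y = ∫ z in s..t, omega α (z - s) • B z y :=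
  ContinuousLinearMap.intervalIntegral_apply
    (intervalIntegrable_omega_smul hα hB hs.1 hs.2 le_rfl) y

lemma intervalIntegrable_kernel_apply [CompleteSpace Y] (hα : 0 < α)
    (hB : ContinuousOn B (Icc 0 t)) (hu : ContinuousOn u (Icc 0 t)) (ht : 0 ≤ t) :
    IntervalIntegrable (fun s => (∫ z in s..t, omega α (z - s) • B z) (u s)) volume 0 t := by
  refine (intervalIntegrable_integral_of_integrableOn_triangle ht
    (integrableOn_omega_smul_clm_triangle hα hB hu)).congr fun s hs => ?_
  rw [uIoc_of_le ht] at hs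
  exact (integral_kernel_apply hα hB ⟨hs.1.le, hs.2⟩ (u s)).symm

lemma integral_integral_kernel_apply [CompleteSpace Y] (hα : 0 < α)
    (hB : ContinuousOn B (Icc 0 t)) (hu : ContinuousOn u (Icc 0 t)) (ht : 0 ≤ t) :
    ∫ s in (0 : ℝ)..t, (∫ z in s..t, omega α (z - s) • B z) (u s)
      = ∫ z in (0 : ℝ)..t, B z (frac α u z) := by
  calc _ = ∫ s in (0 : ℝ)..t, ∫ z in s..t, omega α (z - s) • B z (u s) :=
        intervalIntegral.integral_congr fun s hs =>
          integral_kernel_apply hα hB (by rwa [uIcc_of_le ht] at hs) (u s)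
    _ = ∫ z in (0 : ℝ)..t, ∫ s in (0 : ℝ)..z, omega α (z - s) • B z (u s) :=
        integral_integral_swap_of_integrableOn_triangle ht
          (integrableOn_omega_smul_clm_triangle hα hB hu)
    _ = _ := intervalIntegral.integral_congr fun z hz => by
        rw [uIcc_of_le ht] at hz
        simp only [frac_eq_integral hα hz.1, ← (B z).intervalIntegral_comp_comm
          (intervalIntegrable_omega_sub_smul hα hu hz), map_smul]

/-- The kernel `ω_α(t-s) B(t) + D(s) - ∫_s^t ω_α(z-s) B'(z) dz` with operator coefficients. -/
def weakKernel (α : ℝ) (B B' D : ℝ → Z) (t s : ℝ) : Z :=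
  omega α (t - s) • B t + D s - ∫ z in s..t, omega α (z - s) • B' z

lemma map_weakKernel [CompleteSpace Y] [CompleteSpace Z] {A A' D : ℝ → Z} (L : Z →L[ℝ] Y)
    (hα : 0 < α) (hA' : ContinuousOn A' (Icc 0 T)) (hs : 0 ≤ s) (hst : s ≤ t) (ht : t ≤ T) :
    L (weakKernel α A A' D t s)
      = weakKernel α (fun r => L (A r)) (fun r => L (A' r)) (fun r => L (D r)) t s := by
  rw [weakKernel, map_sub, map_add, map_smul,
    ← L.intervalIntegral_comp_comm (intervalIntegrable_omega_smul hα hA' hs hst ht)]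
  simp only [map_smul, weakKernel]

section apply

variable {B' D : ℝ → Y →L[ℝ] Y}

lemma weakKernel_apply (u : ℝ → Y) (t s : ℝ) :
    weakKernel α B B' D t s (u s) = B t (omega α (t - s) • u s) + D s (u s)
      - (∫ z in s..t, omega α (z - s) • B' z) (u s) := by
  rw [map_smul]
  rfl

lemma intervalIntegrable_map_omega_sub_smul (L : Y →L[ℝ] Z) (hα : 0 < α)
    (hu : ContinuousOn u (Icc 0 T)) (ht : t ∈ Icc 0 T) :
    IntervalIntegrable (fun s => L (omega α (t - s) • u s)) volume 0 t :=
  have h := intervalIntegrable_omega_sub_smul hα hu ht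
  ⟨L.integrable_comp h.1, L.integrable_comp h.2⟩

lemma intervalIntegrable_weakKernel_apply [CompleteSpace Y] (hα : 0 < α)
    (hB' : ContinuousOn B' (Icc 0 t)) (hD : ContinuousOn D (Icc 0 t))
    (hu : ContinuousOn u (Icc 0 t)) (ht : 0 ≤ t) :
    IntervalIntegrable (fun s => weakKernel α B B' D t s (u s)) volume 0 t := by
  simp only [weakKernel_apply]
  exact ((intervalIntegrable_map_omega_sub_smul (B t) hα hu (right_mem_Icc.2 ht)).add
    ((hD.clm_apply hu).intervalIntegrable_of_Icc ht)).sub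
      (intervalIntegrable_kernel_apply hα hB' hu ht)

lemma integral_weakKernel_apply [CompleteSpace Y] (hα : 0 < α)
    (hB' : ContinuousOn B' (Icc 0 t)) (hD : ContinuousOn D (Icc 0 t))
    (hu : ContinuousOn u (Icc 0 t)) (ht : 0 ≤ t) :
    ∫ s in (0 : ℝ)..t, weakKernel α B B' D t s (u s) = volterraOp α B B' D u t := by
  have htt := right_mem_Icc.2 ht
  have hiB := intervalIntegrable_map_omega_sub_smul (B t) hα hu htt
  have hiD := (hD.clm_apply hu).intervalIntegrable_of_Icc (μ := volume) ht
  have hiB' := (hB'.clm_apply (continuousOn_frac hα hu)).intervalIntegrable_of_Icc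
    (μ := volume) ht
  simp only [weakKernel_apply]
  rw [intervalIntegral.integral_sub (hiB.add hiD) (intervalIntegrable_kernel_apply hα hB' hu ht),
    intervalIntegral.integral_add hiB hiD, integral_integral_kernel_apply hα hB' hu ht,
    (B t).intervalIntegral_comp_comm (intervalIntegrable_omega_sub_smul hα hu htt),
    ← frac_eq_integral hα ht, volterraOp, intervalIntegral.integral_sub hiD hiB', add_sub_assoc]

end apply

end kernel

/-! ### The weighted spaces -/

section weightedNorm

variable {Y : Type*} [NormedAddCommGroup Y] [NormedSpace ℝ Y] {T α A : ℝ} {m : ℕ} {v : ℝ → Y}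

lemma rpow_sub_mul_le_iff {t x : ℝ} (ht : 0 < t) (a b : ℝ) :
    t ^ (a - b) * x ≤ A ↔ x ≤ A * t ^ (b - a) := by
  rw [← neg_sub a b, Real.rpow_neg ht.le, ← div_eq_mul_inv,
    le_div_iff₀' (Real.rpow_pos_of_pos ht _)]

lemma weightedSeminorm_nonneg (j : ℕ) : 0 ≤ weightedSeminorm α T j v :=
  Real.sSup_nonneg (forall_mem_image.2 fun _ ht =>
    mul_nonneg (Real.rpow_nonneg ht.1.le _) (norm_nonneg _))

lemma MemWeighted.norm_le_weightedNorm (h : MemWeighted m α T v) {t : ℝ} (ht : t ∈ Icc 0 T) :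
    ‖v t‖ ≤ weightedNorm m α T v :=
  le_add_of_le_of_nonneg
    (le_csSup (isCompact_Icc.image_of_continuousOn h.continuousOn.norm).bddAbove
      (mem_image_of_mem _ ht))
    (Finset.sum_nonneg fun j _ => weightedSeminorm_nonneg j)

lemma weightedSeminorm_le_weightedNorm {j : ℕ} (hj : j ∈ Finset.Icc 1 m) :
    weightedSeminorm α T j v ≤ weightedNorm m α T v :=
  le_add_of_nonneg_of_le (Real.sSup_nonneg (forall_mem_image.2 fun _ _ => norm_nonneg _))
    (Finset.single_le_sum (fun j _ => weightedSeminorm_nonneg j) hj)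

lemma MemWeighted.weightedBound (h : MemWeighted m α T v) :
    WeightedBound T α m v (weightedNorm m α T v) where
  continuousOn := h.continuousOn
  bound _ ht := h.norm_le_weightedNorm ht
  contDiffOn := h.contDiffOn
  norm_iteratedDerivWithin_le j hj _ ht := (rpow_sub_mul_le_iff ht.1 _ _).1
    ((le_csSup (h.bounded j hj) (mem_image_of_mem _ ht)).trans
      (weightedSeminorm_le_weightedNorm hj))

lemma WeightedBound.mem_upperBounds_weightedValues (h : WeightedBound T α m v A) {j : ℕ}
    (hj : j ∈ Finset.Icc 1 m) : A ∈ upperBounds (weightedValues α T j v) :=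
  forall_mem_image.2 fun _ ht =>
    (rpow_sub_mul_le_iff ht.1 _ _).2 (h.norm_iteratedDerivWithin_le j hj _ ht)

lemma WeightedBound.memWeighted (h : WeightedBound T α m v A) : MemWeighted m α T v where
  continuousOn := h.continuousOn
  contDiffOn := h.contDiffOn
  bounded _ hj := ⟨A, h.mem_upperBounds_weightedValues hj⟩

lemma WeightedBound.weightedNorm_le (hT : 0 ≤ T) (h : WeightedBound T α m v A) :
    weightedNorm m α T v ≤ (1 + m) * A := by
  have hA := h.nonneg hT
  have hmax : sSup ((fun t => ‖v t‖) '' Icc 0 T) ≤ A :=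
    Real.sSup_le (forall_mem_image.2 fun _ ht => h.bound _ ht) hA
  have hsum : ∑ j ∈ Finset.Icc 1 m, weightedSeminorm α T j v ≤ m * A := by
    refine (Finset.sum_le_card_nsmul _ _ A fun j hj =>
      Real.sSup_le (h.mem_upperBounds_weightedValues hj) hA).trans_eq ?_
    rw [Nat.card_Icc, Nat.add_sub_cancel, nsmul_eq_mul]
  rw [weightedNorm, add_mul, one_mul]
  exact add_le_add hmax hsum

lemma WeightedBound.clm_const_add {Z : Type*} [NormedAddCommGroup Z] [NormedSpace ℝ Z]
    (L : Y →L[ℝ] Z) (y : Y) (h : WeightedBound T α (m + 1) v A) :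
    WeightedBound T α (m + 1) (fun t => L (y + v t)) (‖L‖ * (‖y‖ + A)) := by
  refine .of_hasDerivWithinAt
    (L.continuous.comp_continuousOn (continuousOn_const.add h.continuousOn))
    (fun t ht => L.le_opNorm_of_le (norm_add_le_of_le le_rfl (h.bound t ht)))
    (fun t ht => L.hasFDerivAt.comp_hasDerivWithinAt t ((h.hasDerivWithinAt ht).const_add y))
    ((h.derivBound_derivWithin.clm L).mono ?_)
  gcongr
  exact le_add_of_nonneg_left (norm_nonneg y)

lemma exists_weightedNorm_le_of_volterraOp_eq [CompleteSpace Y] {B B' D : ℝ → Y →L[ℝ] Y}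
    (hT : 0 < T) (hα : 0 < α) (hα1 : α ≤ 1) (hB : ContDiffOn ℝ m B (Icc 0 T))
    (hB' : ContDiffOn ℝ (m - 1 : ℕ) B' (Icc 0 T)) (hD : ContDiffOn ℝ (m - 1 : ℕ) D (Icc 0 T)) :
    ∃ C > 0, ∀ u f : ℝ → Y, ContinuousOn u (Icc 0 T) → MemWeighted m α T f →
      (∀ t ∈ Icc 0 T, u t + volterraOp α B B' D u t = f t) →
      MemWeighted m α T u ∧ weightedNorm m α T u ≤ C * weightedNorm m α T f := by
  obtain ⟨C, hC, hreg⟩ := exists_weightedBound_of_volterraOp_eq hT hα hα1 m hB hB' hD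
  refine ⟨(1 + m) * C + 1, by positivity, fun u f hu hf heq => ?_⟩
  have hub := hreg u f _ hu hf.weightedBound heq
  have hf0 := hf.weightedBound.nonneg hT.le
  exact ⟨hub.memWeighted, (hub.weightedNorm_le hT.le).trans (by linarith)⟩

end weightedNorm

/-! ### The projected operators -/

section operators

variable {d : ℕ} {Ω : Opens (E d)} {T : ℝ}

section contDiffOn

variable {c : Coeffs Ω} {n : WithTop ℕ∞}

/-- The map `H → V*`, `h ↦ ⟨h, P ·⟩`, for a bounded operator `P : V → H` into a Hilbert space. -/
def pairing {V H : Type*} [NormedAddCommGroup V] [NormedSpace ℝ V] [NormedAddCommGroup H]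
    [InnerProductSpace ℝ H] (P : V →L[ℝ] H) : H →L[ℝ] StrongDual ℝ V :=
  ContinuousLinearMap.precomp ℝ P ∘L innerSL ℝ

lemma drift_eq_sum (F : Fin d → W1inf Ω) :
    drift F = ∑ i, pairing (grad Ω i) ∘L mulL Ω (F i).1.1 := rfl

lemma reaction_eq_comp (a : Linf Ω) : reaction a = pairing (val Ω) ∘L mulL Ω a := rfl

lemma contDiffOn_reaction {a : ℝ → Linf Ω} {s : Set ℝ} (ha : ContDiffOn ℝ n a s) :
    ContDiffOn ℝ n (fun t => reaction (a t)) s := by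
  simp only [reaction_eq_comp]
  exact contDiffOn_const.clm_comp ((mulL Ω).contDiff.comp_contDiffOn ha)

lemma contDiffOn_drift {F : ℝ → Fin d → W1inf Ω} {s : Set ℝ} (hF : ContDiffOn ℝ n F s) :
    ContDiffOn ℝ n (fun t => drift (F t)) s := by
  have hF1 : ∀ i, ContDiffOn ℝ n (fun t => (F t i).1.1) s := fun i =>
    (ContinuousLinearMap.fst ℝ (Linf Ω) (Fin d → Linf Ω) ∘L
      (W1inf Ω).subtypeL).contDiff.comp_contDiffOn (contDiffOn_pi.1 hF i)
  simp only [drift_eq_sum]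
  exact ContDiffOn.sum fun i _ =>
    contDiffOn_const.clm_comp ((mulL Ω).contDiff.comp_contDiffOn (hF1 i))

lemma contDiffOn_K1 {s : Set ℝ} (hF : ContDiffOn ℝ n c.F s) (ha : ContDiffOn ℝ n c.a s) :
    ContDiffOn ℝ n (K1 c) s :=
  (contDiffOn_const.sub ((contDiffOn_drift hF).clm_comp contDiffOn_const)).add
    ((contDiffOn_reaction ha).clm_comp contDiffOn_const)

lemma contDiffOn_K1' {s : Set ℝ} (hF : ContDiffOn ℝ n (derivWithin c.F (Icc 0 T)) s)
    (ha : ContDiffOn ℝ n (derivWithin c.a (Icc 0 T)) s) : ContDiffOn ℝ n (K1' c T) s :=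
  (((contDiffOn_drift hF).neg).clm_comp contDiffOn_const).add
    ((contDiffOn_reaction ha).clm_comp contDiffOn_const)

lemma contDiffOn_K2 {s : Set ℝ} (hG : ContDiffOn ℝ n c.G s) (hb : ContDiffOn ℝ n c.b s) :
    ContDiffOn ℝ n (K2 c) s :=
  (contDiffOn_reaction hb).sub (contDiffOn_drift hG)

end contDiffOn

variable (X : Submodule ℝ (H10 Ω)) [FiniteDimensional ℝ X] {α : ℝ} {c : Coeffs Ω}

/-- `represent X` as a bounded operator on the continuous dual of `X`. -/
def representCLM : StrongDual ℝ X →L[ℝ] X :=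
  ((represent X).toLinearMap ∘ₗ ContinuousLinearMap.coeLM ℝ).toContinuousLinearMap

/-- The compression `R ↦ R_X` of an operator `R : H¹₀(Ω) → H⁻¹(Ω)` to `X`, characterized by
`⟨R_X v, w⟩ = ⟨R v, w⟩` for `v, w ∈ X`. -/
def compress : (H10 Ω →L[ℝ] StrongDual ℝ (H10 Ω)) →L[ℝ] X →L[ℝ] X :=
  ContinuousLinearMap.postcomp X (representCLM X ∘L ContinuousLinearMap.precomp ℝ X.subtypeL) ∘L
    ContinuousLinearMap.precomp (StrongDual ℝ (H10 Ω)) X.subtypeL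

lemma K_eq_weakKernel (c : Coeffs Ω) (α T t s : ℝ) :
    K c α T t s = weakKernel α (K1 c) (K1' c T) (fun r => K2 c r ∘L val Ω) t s :=
  rfl

lemma KX_eq_compress (c : Coeffs Ω) (α T t s : ℝ) : KX X c α T t s = compress X (K c α T t s) :=
  rfl

/-- `projX X` as a bounded operator. -/
def projXCLM : L2 Ω →L[ℝ] X := representCLM X ∘L pairing (valX X)

/-- The coefficient `B` of the projected equation in the form `u + volterraOp α B B' D u = f_X`. -/
def coeffB (c : Coeffs Ω) (t : ℝ) : X →L[ℝ] X := compress X (K1 c t)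

/-- The coefficient `B'` of the projected equation, the derivative of `coeffB`. -/
def coeffB' (c : Coeffs Ω) (T t : ℝ) : X →L[ℝ] X := compress X (K1' c T t)

/-- The coefficient `D` of the projected equation. -/
def coeffD (c : Coeffs Ω) (t : ℝ) : X →L[ℝ] X := compress X (K2 c t ∘L val Ω)

variable {X}

lemma contDiffOn_compress {n : WithTop ℕ∞} {s : Set ℝ}
    {R : ℝ → H10 Ω →L[ℝ] StrongDual ℝ (H10 Ω)} (hR : ContDiffOn ℝ n R s) :
    ContDiffOn ℝ n (fun t => compress X (R t)) s := by
  have h : ContDiff ℝ n (compress X) :=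
    ContinuousLinearMap.contDiff (𝕜 := ℝ) (E := H10 Ω →L[ℝ] StrongDual ℝ (H10 Ω))
      (F := X →L[ℝ] X) (compress X)
  exact h.comp_contDiffOn hR

lemma KX_eq_weakKernel (hα : 0 < α) (hK1' : ContinuousOn (K1' c T) (Icc 0 T)) {s t : ℝ}
    (hs : 0 ≤ s) (hst : s ≤ t) (ht : t ≤ T) :
    KX X c α T t s = weakKernel α (coeffB X c) (coeffB' X c T) (coeffD X c) t s := by
  have : CompleteSpace X := FiniteDimensional.complete ℝ X
  rw [KX_eq_compress, K_eq_weakKernel]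
  exact map_weakKernel (Y := X →L[ℝ] X) (Z := H10 Ω →L[ℝ] StrongDual ℝ (H10 Ω)) (compress X) hα
    hK1' hs hst ht

lemma isSolution_iff (hα : 0 < α) (hK1' : ContinuousOn (K1' c T) (Icc 0 T))
    (hK2 : ContinuousOn (K2 c) (Icc 0 T)) {u₀ : L2 Ω} {g : ℝ → L2 Ω} {u : ℝ → X} :
    IsSolution X c α T u₀ g u ↔ ContinuousOn u (Icc 0 T) ∧
      ∀ t ∈ Icc 0 T, u t + volterraOp α (coeffB X c) (coeffB' X c T) (coeffD X c) u t
        = fX X u₀ g t := by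
  have : CompleteSpace X := FiniteDimensional.complete ℝ X
  have hB' : ContinuousOn (coeffB' X c T) (Icc 0 T) :=
    (compress X).continuous.comp_continuousOn hK1'
  have hD : ContinuousOn (coeffD X c) (Icc 0 T) :=
    (compress X).continuous.comp_continuousOn (hK2.clm_comp continuousOn_const)
  have hop : ContinuousOn u (Icc 0 T) → ∀ t ∈ Icc 0 T,
      IntervalIntegrable (fun s => KX X c α T t s (u s)) volume 0 t ∧
        ∫ s in (0 : ℝ)..t, KX X c α T t s (u s)
          = volterraOp α (coeffB X c) (coeffB' X c T) (coeffD X c) u t := by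
    intro hu t ht
    have hsub : Icc 0 t ⊆ Icc 0 T := Icc_subset_Icc_right ht.2
    have hKX : EqOn (fun s => KX X c α T t s (u s))
        (fun s => weakKernel α (coeffB X c) (coeffB' X c T) (coeffD X c) t s (u s))
        (uIcc 0 t) := fun s hs => by
      rw [uIcc_of_le ht.1] at hs
      simp only [KX_eq_weakKernel hα hK1' hs.1 hs.2 ht.2]
    rw [intervalIntegral.integral_congr hKX, intervalIntegrable_congr (hKX.mono uIoc_subset_uIcc)]
    exact ⟨intervalIntegrable_weakKernel_apply hα (hB'.mono hsub) (hD.mono hsub) (hu.mono hsub)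
      ht.1, integral_weakKernel_apply hα (hB'.mono hsub) (hD.mono hsub) (hu.mono hsub) ht.1⟩
  refine ⟨fun h => ⟨h.continuousOn, fun t ht => ?_⟩, fun h => ⟨h.1, fun t ht => ?_⟩⟩
  · rw [← (hop h.continuousOn t ht).2, (h.eqn t ht).2]
  · rw [(hop h.1 t ht).2]
    exact ⟨(hop h.1 t ht).1, h.2 t ht⟩

variable (X) in
lemma exists_weightedNorm_fX_le (hT : 0 < T) (hα : 0 < α) {m : ℕ} (hm : 1 ≤ m) :
    ∃ P > 0, ∀ (u₀ : L2 Ω) (g : ℝ → L2 Ω) (M : ℝ), ContDiffOn ℝ (m - 1 : ℕ) g (Ioc 0 T) →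
      (∀ i ∈ Finset.Icc 1 m, ∀ t ∈ Ioc 0 T,
        ‖iteratedDerivWithin (i - 1) g (Ioc 0 T) t‖ ≤ M * t ^ (α - (i : ℝ))) →
      MemWeighted m α T (fX X u₀ g) ∧ weightedNorm m α T (fX X u₀ g) ≤ P * (‖u₀‖ + M) := by
  obtain ⟨k, rfl⟩ := Nat.exists_eq_add_of_le' hm
  set q := 1 + T ^ α / α
  have hq1 : 1 ≤ q := le_add_of_nonneg_right (by positivity)
  refine ⟨(1 + (k + 1 : ℕ)) * (‖projXCLM X‖ * q) + 1, by positivity, fun u₀ g M hg hM => ?_⟩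
  have hgb : DerivBound T k (α - 1) g M :=
    ⟨hg, fun j hj t ht => by
      have := hM (j + 1) (Finset.mem_Icc.2 ⟨by omega, by omega⟩) t ht
      rwa [Nat.add_sub_cancel, Nat.cast_add_one, sub_add_eq_sub_sub_swap] at this⟩
  have hM0 := hgb.nonneg hT
  have hf : WeightedBound T α (k + 1) (fX X u₀ g) (‖projXCLM X‖ * (‖u₀‖ + q * M)) :=
    (hgb.weightedBound_primitive hT hα).clm_const_add (projXCLM X) u₀
  refine ⟨hf.memWeighted, (hf.weightedNorm_le hT.le).trans ?_⟩
  have hu₀ : ‖u₀‖ ≤ q * ‖u₀‖ := le_mul_of_one_le_left (norm_nonneg _) hq1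
  calc (1 + (k + 1 : ℕ)) * (‖projXCLM X‖ * (‖u₀‖ + q * M))
      ≤ (1 + (k + 1 : ℕ)) * (‖projXCLM X‖ * (q * ‖u₀‖ + q * M)) := by gcongr
    _ = (1 + (k + 1 : ℕ)) * (‖projXCLM X‖ * q) * (‖u₀‖ + M) := by ring
    _ ≤ _ := mul_le_mul_of_nonneg_right (le_add_of_nonneg_right zero_le_one) (by positivity)

end operators

end FracPDE

end

open FracPDE in
theorem theorem3p2_general {d : ℕ} {Ω : TopologicalSpace.Opens (E d)} {α T : ℝ} (hα0 : 0 < α)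
    (hα1 : α ≤ 1) (hT : 0 < T) {m : ℕ} (hm : 1 ≤ m) {c : Coeffs Ω}
    (hF : ContDiffOn ℝ m c.F (Set.Icc 0 T))
    (hG : ContDiffOn ℝ (m - 1 : ℕ) c.G (Set.Icc 0 T))
    (ha : ContDiffOn ℝ m c.a (Set.Icc 0 T))
    (hb : ContDiffOn ℝ (m - 1 : ℕ) c.b (Set.Icc 0 T))
    (X : Submodule ℝ (H10 Ω)) [FiniteDimensional ℝ X] :
    ∃ C₁ > 0, ∃ C₂ > 0, ∀ (u₀ : L2 Ω) (g : ℝ → L2 Ω) (M : ℝ),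
      ContDiffOn ℝ (m - 1 : ℕ) g (Set.Ioc 0 T) →
      (∀ i ∈ Finset.Icc 1 m, ∀ t ∈ Set.Ioc 0 T,
        ‖iteratedDerivWithin (i - 1) g (Set.Ioc 0 T) t‖ ≤ M * t ^ (α - (i : ℝ))) →
      ∃ uX : ℝ → X, IsSolution X c α T u₀ g uX ∧
        (∀ v : ℝ → X, IsSolution X c α T u₀ g v → Set.EqOn v uX (Set.Icc 0 T)) ∧
        MemWeighted m α T (fX X u₀ g) ∧ MemWeighted m α T uX ∧
        weightedNorm m α T uX ≤ C₁ * weightedNorm m α T (fX X u₀ g) ∧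
        C₁ * weightedNorm m α T (fX X u₀ g) ≤ C₂ * (‖u₀‖ + M) := by
  have : CompleteSpace X := FiniteDimensional.complete ℝ X
  have hu := uniqueDiffOn_Icc hT
  have hmm : ((m - 1 : ℕ) : WithTop ℕ∞) + 1 ≤ m := by exact_mod_cast (Nat.sub_add_cancel hm).le
  have hK1' := contDiffOn_K1' (hF.derivWithin hu hmm) (ha.derivWithin hu hmm)
  have hK2 := contDiffOn_K2 hG hb
  have hB : ContDiffOn ℝ m (coeffB X c) (Set.Icc 0 T) := contDiffOn_compress (contDiffOn_K1 hF ha)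
  have hB' : ContDiffOn ℝ (m - 1 : ℕ) (coeffB' X c T) (Set.Icc 0 T) := contDiffOn_compress hK1'
  have hD : ContDiffOn ℝ (m - 1 : ℕ) (coeffD X c) (Set.Icc 0 T) :=
    contDiffOn_compress (hK2.clm_comp contDiffOn_const)
  have hV := isVolterra_volterraOp hα0 hα1 hB.continuousOn hB'.continuousOn hD.continuousOn
  obtain ⟨C, hC, hreg⟩ := exists_weightedNorm_le_of_volterraOp_eq hT hα0 hα1 hB hB' hD
  obtain ⟨P, hP, hdata⟩ := exists_weightedNorm_fX_le X hT hα0 hm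
  refine ⟨C, hC, C * P, mul_pos hC hP, fun u₀ g M hg hM => ?_⟩
  obtain ⟨hf, hfP⟩ := hdata u₀ g M hg hM
  obtain ⟨u, hu, hue⟩ := hV.exists_solution (half_pos hα0) hT.le hf.continuousOn
  obtain ⟨hum, hun⟩ := hreg u _ hu hf hue
  refine ⟨u, (isSolution_iff hα0 hK1'.continuousOn hK2.continuousOn).2 ⟨hu, hue⟩,
    fun v hv => ?_, hf, hum, hun, ?_⟩
  · obtain ⟨hvc, hve⟩ := (isSolution_iff hα0 hK1'.continuousOn hK2.continuousOn).1 hv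
    exact hV.eqOn_of_add_eq (half_pos hα0) hvc hu fun t ht => (hve t ht).trans (hue t ht).symm
  · rw [mul_assoc]
    exact mul_le_mul_of_nonneg_left hfP hC.le

open FracPDE in
theorem theorem3p2 {d : ℕ} (hd : 1 ≤ d) (Ω : TopologicalSpace.Opens (E d))
    (hΩ : Bornology.IsBounded (Ω : Set (E d)))
    (α T : ℝ) (hα0 : 0 < α) (hα1 : α < 1) (hT : 0 < T)
    (m : ℕ) (hm : 1 ≤ m) (c : Coeffs Ω)
    -- `κ(x)` is symmetric positive-definite with minimal eigenvalue bounded away from zero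
    (hκ : ∃ lam > 0, ∀ᵐ x ∂(vol Ω), (Matrix.of fun i j => c.κ i j x).PosDef ∧
      ∀ μ ∈ spectrum ℝ (Matrix.of fun i j => c.κ i j x), lam ≤ μ)
    (hF : ContDiffOn ℝ (m + 1 : ℕ) c.F (Set.Icc 0 T))
    (hG : ContDiffOn ℝ (m + 1 : ℕ) c.G (Set.Icc 0 T))
    (ha : ContDiffOn ℝ m c.a (Set.Icc 0 T))
    (hb : ContDiffOn ℝ m c.b (Set.Icc 0 T))
    (X : Submodule ℝ (H10 Ω)) [FiniteDimensional ℝ X] :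
    ∃ C₁ > 0, ∃ C₂ > 0, ∀ (u₀ : L2 Ω) (g : ℝ → L2 Ω) (M : ℝ),
      ContDiffOn ℝ m g (Set.Ioc 0 T) →
      (∀ i ∈ Finset.Icc 1 m, ∀ t ∈ Set.Ioc 0 T,
        ‖iteratedDerivWithin (i - 1) g (Set.Ioc 0 T) t‖ ≤ M * t ^ (α - (i : ℝ))) →
      ∃ uX : ℝ → X, IsSolution X c α T u₀ g uX ∧
        (∀ v : ℝ → X, IsSolution X c α T u₀ g v → Set.EqOn v uX (Set.Icc 0 T)) ∧
        MemWeighted m α T (fX X u₀ g) ∧ MemWeighted m α T uX ∧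
        weightedNorm m α T uX ≤ C₁ * weightedNorm m α T (fX X u₀ g) ∧
        C₁ * weightedNorm m α T (fX X u₀ g) ≤ C₂ * (‖u₀‖ + M) := by
  have hle : ((m - 1 : ℕ) : WithTop ℕ∞) ≤ m := by exact_mod_cast m.sub_le 1
  have hle' : (m : WithTop ℕ∞) ≤ (m + 1 : ℕ) := by exact_mod_cast m.le_succ
  obtain ⟨C₁, hC₁, C₂, hC₂, h⟩ := theorem3p2_general hα0 hα1.le hT hm (hF.of_le hle')
    (hG.of_le (hle.trans hle')) ha (hb.of_le hle) X
  exact ⟨C₁, hC₁, C₂, hC₂, fun u₀ g M hg => h u₀ g M (hg.of_le hle)⟩
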